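/- All graphs are finite and simple; $d_G(v)$ is the degree of $v$ in $G$ and $\delta(G)$ the minimum degree. A cycle is a graph $C_n$ with $n\ge 3$. Let $\mathcal C$ be the class of graphs in which every connected component contains a cycle. An orientation of $G$ (each edge gets exactly one direction) is valid if every vertex has in-degree at least $1$. A total dominating set of a digraph $D$ is a set $S$ of vertices such that every vertex has an in-neighbour in $S$; $\gamma_t(D)$ is the least size of such a set, and for $G\in\mathcal C$ we let $\mathrm{DOM}_t(G)$ be the maximum of $\gamma_t(D)$ over all valid orientations $D$ of $G$. Families of graphs: $\mathcal F_1$: the connected graphs $G\in\mathcal C$ with $\delta(G)=1$ and exactly one vertex $s$ of degree $1$, for which there is a path $s=w_0,w_1,\dots,w_k$ with $k\ge 1$ such that the vertices off the path induce a disjoint union of $\ell\ge 0$ cycles, every edge of $G$ other than the edges of the path and of these cycles is incident with $w_k$, the vertex $w_k$ is adjacent to at least one vertex of each of the $\ell$ cycles, and $d_G(w_k)\ge 2$. $\mathcal F_2$: the connected graphs $G\in\mathcal C$ with $\delta(G)\ge 2$ that have a vertex $s$ with $d_G(s)\ge 2$ such that $G-s$ is a disjoint union of $\ell\ge 1$ cycles,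 each containing a neighbour of $s$. $\mathcal F_3$: the connected graphs $G\in\mathcal C$ that arise from some $R\in\mathcal F_1$, with $s,w_1,\dots,w_k$ as above, either by adding one new edge between $s$ and any other vertex not adjacent to $s$ in $R$, or by adding two distinct new edges $e_1,e_2$ incident with $s$ such that one of the following holds. (a) $e_1=sw_k$ (so $k>1$), and $e_2$ is arbitrary. (b) $d_R(w_k)=2$; $x$ is the only vertex other than $w_k$ with $d_R(x)=3$; $e_1=sw_{i-1}$ if $x=w_i$ is on the path, and $e_1=sx'$ with $x'$ a neighbour of $x$ on its cycle if $x$ is on one of the $\ell$ cycles; and $e_2$ is arbitrary. (c) $d_R(w_k)=3$; $x\ne y$ are the two vertices other than $w_k$ of degree $3$ in $R$; $e_1=sx'$ and $e_2=sy'$, where $x'=w_{i-1}$ if $x=w_i$ is on the path, $x'$ is a neighbour of $x$ on its cycle if $x$ is on one of the $\ell$ cycles, and $y'$ is related to $y$ in the same way; moreover, if $x$ and $y$ lie on the same one of the $\ell$ cycles, then $x'$ and $y'$ follow $x$ and $y$, respectively, in the same direction around that cycle. Theorem. Let $G\in\mathcal C$. If $G$ is connected, then $\mathrm{DOM}_t(G)=|V(G)|-1$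 if and only if $G\in\mathcal F_1\cup\mathcal F_2\cup\mathcal F_3$. If $G$ is not connected and $\mathrm{DOM}_t(G)=|V(G)|-1$, then $G$ is a disjoint union of some cycles and one graph $G_0\in\mathcal F_1\cup\mathcal F_2\cup\mathcal F_3$. -/

import Mathlib

namespace OrientableTotalDomination

/-! ### Orientations and total domination -/

/-- `D` is an orientation of the simple graph `G`: every edge of `G` receives exactly one of its
two directions, and `D` has no other arcs. -/
structure IsOrientation {V : Type*} (D : Digraph V) (G : SimpleGraph V) : Prop where
  adj_iff : ∀ u v, G.Adj u v ↔ D.Adj u v ∨ D.Adj v u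
  asymm : ∀ u v, D.Adj u v → ¬ D.Adj v u

/-- A valid orientation: every vertex has at least one in-neighbour. -/
structure IsValidOrientation {V : Type*} (D : Digraph V) (G : SimpleGraph V) : Prop where
  isOrientation : IsOrientation D G
  in_pos : ∀ v, ∃ u, D.Adj u v

/-- `S` is a total dominating set of `D`: every vertex has an in-neighbour in `S`. -/
def IsTotalDominatingSet {V : Type*} (D : Digraph V) (S : Finset V) : Prop :=
  ∀ v, ∃ u ∈ S, D.Adj u v

/-- The total domination number `γ_t(D)`: the least size of a total dominating set. (Such a set
exists for a finite digraph in which every vertex has an in-neighbour.) -/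
noncomputable def totalDominationNumber {V : Type*} (D : Digraph V) : ℕ :=
  sInf {n | ∃ S : Finset V, IsTotalDominatingSet D S ∧ S.card = n}

/-- `DOM_t(G)`: the maximum of `γ_t(D)` over the valid orientations `D` of `G`. (For a finite
graph the values are bounded by the number of vertices; a valid orientation exists if every
component of `G` contains a cycle.) -/
noncomputable def upperOrientableTotalDominationNumber {V : Type*} (G : SimpleGraph V) : ℕ :=
  sSup {n | ∃ D : Digraph V, IsValidOrientation D G ∧ totalDominationNumber D = n}

/-- The class `𝒞`: every connected component contains a cycle. -/
def EveryComponentHasCycle {V : Type*} (G : SimpleGraph V) : Prop :=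
  ∀ c : G.ConnectedComponent, ∃ v ∈ c.supp, ∃ p : G.Walk v v, p.IsCycle

/-! ### Cycles and degrees -/

/-- `G` is a cycle `C_n` for some `n ≥ 3`. -/
def IsCycleGraph {V : Type*} (G : SimpleGraph V) : Prop :=
  ∃ n, 3 ≤ n ∧ Nonempty (G ≃g SimpleGraph.cycleGraph n)

/-- `G` is a vertex-disjoint union of cycles (possibly of no cycle at all). -/
def IsDisjointUnionOfCycles {V : Type*} (G : SimpleGraph V) : Prop :=
  ∀ c : G.ConnectedComponent, IsCycleGraph c.toSimpleGraph

/-- The degree of a vertex, without instance arguments. -/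
noncomputable def deg {V : Type*} (G : SimpleGraph V) (v : V) : ℕ := (G.neighborSet v).ncard

/-! ### The family `F₁` -/

/-- The vertex set `{s, w₁, …, w_k}` of the path `s = w 0, w 1, …, w k`. -/
def pathVertices {V : Type*} (k : ℕ) (w : ℕ → V) : Set V := w '' Set.Iic k

/-- The graph induced by `G` on the vertices that are not on the path. -/
abbrev offPath {V : Type*} (G : SimpleGraph V) (k : ℕ) (w : ℕ → V) :
    SimpleGraph ↥((pathVertices k w)ᶜ) :=
  G.induce (pathVertices k w)ᶜ

/-- The path `s = w 0, w 1, …, w k` exhibits `G` as a member of `F₁`. -/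
structure IsF1Path {V : Type*} (G : SimpleGraph V) (k : ℕ) (w : ℕ → V) : Prop where
  /-- the minimum degree is at least one -/
  one_le_deg : ∀ v, 1 ≤ deg G v
  /-- `s = w 0` has degree one, and it is the only such vertex -/
  deg_eq_one_iff : ∀ v, deg G v = 1 ↔ v = w 0
  one_le_length : 1 ≤ k
  injOn : Set.InjOn w (Set.Iic k)
  path_adj : ∀ i < k, G.Adj (w i) (w (i + 1))
  /-- the remaining vertices carry `ℓ ≥ 0` vertex-disjoint cycles -/
  cycles : IsDisjointUnionOfCycles (offPath G k w)
  /-- each edge is an edge of the path, or an edge of one of the cycles, or incident with `w k` -/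
  edges : ∀ u v, G.Adj u v →
    (∃ i < k, s(u, v) = s(w i, w (i + 1))) ∨
    (u ∉ pathVertices k w ∧ v ∉ pathVertices k w) ∨ u = w k ∨ v = w k
  /-- `w k` is adjacent to at least one vertex of each of the cycles -/
  touches : ∀ c : (offPath G k w).ConnectedComponent, ∃ v ∈ c.supp, G.Adj (w k) v
  two_le_deg : 2 ≤ deg G (w k)

/-- The family `F₁`. -/
def InF1 {V : Type*} (G : SimpleGraph V) : Prop :=
  G.Connected ∧ EveryComponentHasCycle G ∧ ∃ (k : ℕ) (w : ℕ → V), IsF1Path G k w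

/-! ### The family `F₂` -/

/-- The family `F₂`: removing the vertex `s` leaves `ℓ ≥ 1` vertex-disjoint cycles, each of which
contains a neighbour of `s`. -/
def InF2 {V : Type*} (G : SimpleGraph V) : Prop :=
  G.Connected ∧ EveryComponentHasCycle G ∧ (∀ v, 2 ≤ deg G v) ∧
    ∃ s : V, (∃ v, v ≠ s) ∧ IsDisjointUnionOfCycles (G.induce {s}ᶜ) ∧
      (∀ c : (G.induce {s}ᶜ).ConnectedComponent, ∃ v ∈ c.supp, G.Adj s v) ∧ 2 ≤ deg G s

/-! ### The family `F₃` -/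

/-- `x ≠ w k` is a vertex of degree three and `a` is a neighbour of `x` of the following kind:
if `x = w (i + 1)` is on the path then `a = w i`, and if `x` is on one of the cycles off the path,
then `a` is the vertex that follows `x` on its cycle when the cycles are traversed in the
directions given by `D`. (A valid orientation `D` of a disjoint union of cycles makes each of the
cycles a directed circuit.) -/
structure IsPartner {V : Type*} (R : SimpleGraph V) (k : ℕ) (w : ℕ → V)
    (D : Digraph ↥((pathVertices k w)ᶜ)) (x a : V) : Prop where
  ne_last : x ≠ w k
  deg_eq : deg R x = 3
  follows : (∃ i, i + 1 < k ∧ x = w (i + 1) ∧ a = w i) ∨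
    ∃ (hx : x ∈ (pathVertices k w)ᶜ) (ha : a ∈ (pathVertices k w)ᶜ), D.Adj ⟨x, hx⟩ ⟨a, ha⟩

/-- The condition under which the two further edges `s a` and `s b`, where `s = w 0`, may be added
to the graph `R` from `F₁`. -/
def TwoEdgeCondition {V : Type*} (R : SimpleGraph V) (k : ℕ) (w : ℕ → V) (a b : V) : Prop :=
  (4 ≤ deg R (w k) ∧ 1 < k ∧ a = w k) ∨
  (deg R (w k) = 3 ∧
    ((1 < k ∧ a = w k) ∨
      ∃ D, IsValidOrientation D (offPath R k w) ∧
        ∃ x y, x ≠ y ∧ IsPartner R k w D x a ∧ IsPartner R k w D y b)) ∨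
  (deg R (w k) = 2 ∧
    ((1 < k ∧ a = w k) ∨
      ∃ D, IsValidOrientation D (offPath R k w) ∧ ∃ x, IsPartner R k w D x a))

/-- The family `F₃`: the graphs obtained from a graph `R` in `F₁` by adding one new edge at `s`,
or two new edges at `s` that satisfy `TwoEdgeCondition`. -/
def InF3 {V : Type*} (G : SimpleGraph V) : Prop :=
  G.Connected ∧ EveryComponentHasCycle G ∧
    ∃ R : SimpleGraph V, InF1 R ∧ ∃ (k : ℕ) (w : ℕ → V), IsF1Path R k w ∧
      ((∃ a, a ≠ w 0 ∧ ¬ R.Adj (w 0) a ∧ G = R ⊔ SimpleGraph.edge (w 0) a) ∨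
        ∃ a b, a ≠ b ∧ a ≠ w 0 ∧ b ≠ w 0 ∧ ¬ R.Adj (w 0) a ∧ ¬ R.Adj (w 0) b ∧
          TwoEdgeCondition R k w a b ∧
          G = R ⊔ SimpleGraph.edge (w 0) a ⊔ SimpleGraph.edge (w 0) b)

/-- Membership in `F₁ ∪ F₂ ∪ F₃`. -/
def InF {V : Type*} (G : SimpleGraph V) : Prop := InF1 G ∨ InF2 G ∨ InF3 G

end OrientableTotalDomination

/-!
A valid orientation `D` has `γ_t(D) = n` exactly if each vertex is the only in-neighbour of some
vertex, that is, if `D` consists of directed cycles. Call a vertex dispensable if it is not the only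
in-neighbour of any vertex. Then `γ_t(D) ≥ n - 1` means that each pair of vertices contains all
in-neighbours of some vertex (`PairCritical`), so that each pair of dispensable vertices is an
in-neighbourhood. As the in-neighbourhoods also include the `n - b` singletons of the other
vertices, the number `b` of dispensable vertices satisfies `n - b + b (b - 1) / 2 ≤ n`, hence
`b ≤ 3` (`card_dispensable_le`).

In each of the cases `b = 1, 2, 3` there are a vertex `s` and a permutation `σ` such that
`v → σ v` is an arc for all `v ≠ s`, and all other arcs end at `σ s` or start at `s`
(`IsAlmostCyclic`). The cycle of `σ` through `s` is the path `s = w 0, …, w k = σ s` of the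
families, followed backwards, and the other cycles of `σ` are the `ℓ` cycles. Without the
arcs that leave `s`, the graph belongs to `F₁`; the at most two arcs that leave `s` are the edges added in `F₃`. The
family `F₂` is the case `σ s = s`. The permutation has to be chosen such that the graph without the
arcs at `s` remains connected, see `inF_of_one`, `inF_of_two` and `inF_of_three`.

Conversely, the path and the cycles of a graph in one of the families define such a permutation
(`IsSpine`). The orientation that follows `σ`, directs the remaining edges towards `σ s`, and
directs the added edges away from `s` has `γ_t ≥ n - 1` (`pairCritical_spineDigraph`), and
no orientation has `γ_t = n`, since some vertex has degree at least three (`IsSpine.exists_dispensable`).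

If `G` is not connected, the dispensable vertices of an extremal orientation lie in one component
(`PairCritical.eq_connectedComponentMk`), to which the connected case applies. The other components
are directed cycles.
-/

namespace OrientableTotalDomination

open Function Equiv

/-! ### Disjoint unions of cycles and permutations -/

lemma mem_of_adj_closed {V : Type*} {G : SimpleGraph V} (hG : G.Preconnected) {S : Set V}
    (hS : ∀ u ∈ S, ∀ v, G.Adj u v → v ∈ S) {u : V} (hu : u ∈ S) (v : V) : v ∈ S := by
  obtain ⟨p⟩ := hG u v
  induction p with
  | nil => exact hu
  | cons h _ ih => exact ih (hS _ hu _ h)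

/-- A connected graph whose edges are the pairs `{u, σ u}` is a single cycle: the iterates of `σ`
at any vertex run through all vertices. -/
lemma isCycleGraph_of_perm {W : Type*} [Finite W] {H : SimpleGraph W} (hH : H.Connected)
    (σ : Perm W) (hadj : ∀ u v, H.Adj u v ↔ v = σ u ∨ u = σ v) (h2 : ∀ u, σ (σ u) ≠ u) :
    IsCycleGraph H := by
  obtain ⟨u₀⟩ := hH.nonempty
  have h1 : ∀ u, σ u ≠ u := fun u h => h2 u (by rw [h, h])
  have hpos := minimalPeriod_pos_of_mem_periodicPts (σ.injective.mem_periodicPts u₀)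
  obtain ⟨m, hm⟩ : ∃ m, minimalPeriod σ u₀ = m + 3 := by
    have hp := isPeriodicPt_minimalPeriod σ u₀
    refine ⟨minimalPeriod σ u₀ - 3, ?_⟩
    by_contra hlt
    obtain h | h : minimalPeriod σ u₀ = 1 ∨ minimalPeriod σ u₀ = 2 := by omega
    · rw [h] at hp; exact h1 u₀ hp
    · rw [h] at hp; exact h2 u₀ hp
  let f : Fin (m + 3) → W := fun i => σ^[i.val] u₀
  have hsucc : ∀ i, f (i + 1) = σ (f i) := by
    intro i
    have : (i + 1).val = (i.val + 1) % minimalPeriod σ u₀ := by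
      rw [hm, Fin.val_add]; rfl
    simp only [f]
    rw [this, iterate_mod_minimalPeriod_eq, iterate_succ_apply']
  have hinj : Injective f := fun i j hij => Fin.ext <|
    iterate_injOn_Iio_minimalPeriod (by simp [hm]) (by simp [hm]) hij
  have hpred : ∀ i w, f i = σ w → w = f (i - 1) := by
    intro i w h
    rw [← sub_add_cancel i 1, hsucc] at h
    exact (σ.injective h).symm
  have hsurj : ∀ w, w ∈ Set.range f := by
    refine mem_of_adj_closed hH.preconnected ?_ (Set.mem_range_self 0)
    rintro _ ⟨i, rfl⟩ v hv
    rcases (hadj _ _).1 hv with h | h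
    · exact ⟨i + 1, (hsucc i).trans h.symm⟩
    · exact ⟨i - 1, (hpred _ _ h).symm⟩
  have key : ∀ i j, f j = σ (f i) ↔ j - i = 1 := by
    intro i j
    rw [← hsucc, hinj.eq_iff, sub_eq_iff_eq_add, add_comm 1 i]
  refine ⟨m + 3, by omega, ⟨RelIso.symm ⟨Equiv.ofBijective f ⟨hinj, hsurj⟩, ?_⟩⟩⟩
  intro i j
  change H.Adj (f i) (f j) ↔ _
  rw [hadj, key, key, SimpleGraph.cycleGraph_adj, or_comm]

lemma isDisjointUnionOfCycles_of_perm {W : Type*} [Finite W] {H : SimpleGraph W}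
    (σ : Perm W) (hadj : ∀ u v, H.Adj u v ↔ v = σ u ∨ u = σ v) (h2 : ∀ u, σ (σ u) ≠ u) :
    IsDisjointUnionOfCycles H := by
  intro c
  have hσ : ∀ u, u ∈ c.supp → σ u ∈ c.supp := fun u hu =>
    c.mem_supp_of_adj_mem_supp hu ((hadj u _).2 (Or.inl rfl))
  refine isCycleGraph_of_perm c.connected_toSimpleGraph (σ.subtypePermOfFintype hσ) ?_ ?_
  · rintro ⟨u, hu⟩ ⟨v, hv⟩
    rw [Subtype.ext_iff, Subtype.ext_iff]
    exact hadj u v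
  · rintro ⟨u, hu⟩ h
    exact h2 u (congrArg Subtype.val h)

/-- Going one step around each of the cycles is a permutation. -/
lemma IsDisjointUnionOfCycles.exists_perm {W : Type*} [Finite W] {H : SimpleGraph W}
    (hH : IsDisjointUnionOfCycles H) :
    ∃ σ : Perm W, (∀ u v, H.Adj u v ↔ v = σ u ∨ u = σ v) ∧ ∀ u, σ (σ u) ≠ u := by
  choose n hn e using hH
  have hstep : ∀ c : H.ConnectedComponent, ∃ τ : Perm c,
      (∀ u v, c.toSimpleGraph.Adj u v ↔ v = τ u ∨ u = τ v) ∧ ∀ u, τ (τ u) ≠ u := by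
    intro c
    obtain ⟨e⟩ := e c
    obtain ⟨m, hm⟩ := Nat.exists_eq_add_of_le' (hn c)
    generalize n c = n' at e hm
    subst hm
    refine ⟨(e.toEquiv.trans (Equiv.addRight 1)).trans e.toEquiv.symm, ?_, ?_⟩
    · intro u v
      rw [← e.map_adj_iff, SimpleGraph.cycleGraph_adj, or_comm]
      simp [Equiv.eq_symm_apply, sub_eq_iff_eq_add, add_comm]
    · intro u h
      simp [Equiv.symm_apply_eq, add_assoc] at h
      have := congrArg Fin.val h
      rw [Fin.val_add, Fin.val_one, Nat.mod_eq_of_lt (by omega)] at this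
      simp at this
  choose τ hτ hτ2 using hstep
  let f : W → W := fun u => (τ (H.connectedComponentMk u) ⟨u, rfl⟩).1
  have hf : ∀ c (u : W) (hu : u ∈ c.supp), f u = (τ c ⟨u, hu⟩).1 := by
    rintro c u rfl; rfl
  have hfm : ∀ u, H.connectedComponentMk (f u) = H.connectedComponentMk u := fun u =>
    (τ (H.connectedComponentMk u) ⟨u, rfl⟩).2
  have hinj : Injective f := by
    intro u v huv
    have hc : H.connectedComponentMk u = H.connectedComponentMk v := by
      rw [← hfm u, huv, hfm]
    rw [hf _ u hc, hf _ v rfl] at huv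
    exact congrArg Subtype.val ((τ _).injective (Subtype.ext huv))
  refine ⟨Equiv.ofBijective f (Finite.injective_iff_bijective.1 hinj), ?_, ?_⟩
  · intro u v
    simp only [Equiv.ofBijective_apply]
    have hadj : ∀ u v (h : H.connectedComponentMk v = H.connectedComponentMk u),
        H.Adj u v ↔ v = f u ∨ u = f v := by
      intro u v h
      rw [hf _ u rfl, hf _ v h]
      have := hτ _ ⟨u, rfl⟩ ⟨v, h⟩
      rw [Subtype.ext_iff, Subtype.ext_iff] at this
      exact this
    constructor
    · intro h
      exact (hadj u v (SimpleGraph.ConnectedComponent.sound h.symm.reachable)).1 h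
    · intro h
      refine (hadj u v ?_).2 h
      rcases h with h | h
      · rw [h, hfm]
      · rw [h, hfm]
  · intro u h
    simp only [Equiv.ofBijective_apply] at h
    rw [hf _ (f u) (hfm u)] at h
    exact hτ2 _ ⟨u, rfl⟩ (Subtype.ext h)

/-- A valid orientation of a disjoint union of cycles is directed along each of the cycles. If two
vertices had the same in-neighbour `x`, then both edges at `x` would leave `x`. -/
lemma IsDisjointUnionOfCycles.exists_perm_of_orientation {W : Type*} [Finite W]
    {H : SimpleGraph W} (hH : IsDisjointUnionOfCycles H) {D : Digraph W}
    (hD : IsValidOrientation D H) : ∃ σ : Perm W, ∀ u v, D.Adj u v ↔ v = σ u := by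
  obtain ⟨τ, hτ, hτ2⟩ := hH.exists_perm
  have has := hD.isOrientation.asymm
  have hnb : ∀ u v, D.Adj u v ∨ D.Adj v u → v = τ u ∨ u = τ v := fun u v h =>
    (hτ u v).1 ((hD.isOrientation.adj_iff u v).2 h)
  choose p hp using hD.in_pos
  have hinj : Injective p := by
    intro u v huv
    by_contra hne
    have h1 := hnb _ _ (Or.inl (hp u))
    have h2 := hnb _ _ (Or.inl (hp v))
    have h3 := hnb _ _ (Or.inl (hp (p u)))
    rw [← huv] at h2
    have a1 := has _ _ (hp u)
    have a2 := has _ _ (hp v)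
    have a3 := hp (p u)
    have : p (p u) = u ∨ p (p u) = v := by
      have i := τ.injective
      rcases h1 with h1 | h1 <;> rcases h2 with h2 | h2 <;> rcases h3 with h3 | h3 <;>
        grind [i.eq_iff]
    grind
  let σ := (Equiv.ofBijective p (Finite.injective_iff_bijective.1 hinj)).symm
  have hσ : ∀ u, D.Adj u (σ u) := by
    intro u
    have h := hp (σ u)
    rwa [show p (σ u) = u from (Equiv.ofBijective p _).apply_symm_apply u] at h
  refine ⟨σ, fun u v => ⟨fun h => ?_, fun h => h ▸ hσ u⟩⟩
  have h1 := hnb _ _ (Or.inl h)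
  have h2 := hnb _ _ (Or.inl (hσ u))
  have h3 := hnb _ _ (Or.inl (hp u))
  have a1 := has _ _ (hp u)
  have a2 := has _ _ (hσ u)
  have a3 := has _ _ h
  have a4 := hp u
  have i := τ.injective
  rcases h1 with h1 | h1 <;> rcases h2 with h2 | h2 <;> rcases h3 with h3 | h3 <;>
        grind [i.eq_iff]

lemma IsDisjointUnionOfCycles.exists_validOrientation {W : Type*} [Finite W]
    {H : SimpleGraph W} (hH : IsDisjointUnionOfCycles H) :
    ∃ D : Digraph W, IsValidOrientation D H := by
  obtain ⟨σ, hσ, hσ2⟩ := hH.exists_perm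
  refine ⟨⟨fun u v => v = σ u⟩, ⟨hσ, ?_⟩, fun v => ⟨σ.symm v, (σ.apply_symm_apply v).symm⟩⟩
  rintro u _ rfl h
  exact hσ2 u h.symm

/-! ### Existence of cycles and adjacency to components of induced subgraphs -/

/-- If `p` chooses a neighbour of each vertex such that no edge is chosen from both ends, then
there are at least as many edges as vertices. -/
lemma exists_isCycle_of_choice {V : Type*} [Finite V] {G : SimpleGraph V}
    (hG : G.Connected) (p : V → V) (hp : ∀ v, G.Adj (p v) v) (hp2 : ∀ v, p (p v) ≠ v) :
    ∃ (v : V) (q : G.Walk v v), q.IsCycle := by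
  classical
  have := Fintype.ofFinite V
  by_contra hcon
  have hac : G.IsAcyclic := fun v q hq => hcon ⟨v, q, hq⟩
  have hcard := (SimpleGraph.IsTree.mk hG hac).card_edgeFinset
  have hle : Fintype.card V ≤ G.edgeFinset.card := by
    rw [← Finset.card_univ]
    refine Finset.card_le_card_of_injOn (fun v => s(p v, v)) ?_ ?_
    · intro v _
      simpa using hp v
    · intro u _ v _ huv
      rcases Sym2.eq_iff.1 huv with h | h
      · exact h.2
      · exact absurd (by rw [← h.2, h.1]) (hp2 v)
  omega

lemma everyComponentHasCycle_of_choice {V : Type*} [Finite V] {G : SimpleGraph V}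
    (p : V → V) (hp : ∀ v, G.Adj (p v) v) (hp2 : ∀ v, p (p v) ≠ v) :
    EveryComponentHasCycle G := by
  intro c
  have hm : ∀ v : c, p v ∈ c.supp := fun v => c.mem_supp_of_adj_mem_supp v.2 (hp v).symm
  obtain ⟨v, q, hq⟩ := exists_isCycle_of_choice c.connected_toSimpleGraph
    (fun v => ⟨p v, hm v⟩) (fun v => hp v) fun v h => hp2 v (congrArg Subtype.val h)
  exact ⟨v, v.2, q.map c.toSimpleGraph_hom, hq.map Subtype.val_injective⟩

lemma IsValidOrientation.everyComponentHasCycle {V : Type*} [Finite V] {G : SimpleGraph V}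
    {D : Digraph V} (hD : IsValidOrientation D G) : EveryComponentHasCycle G := by
  choose p hp using hD.in_pos
  exact everyComponentHasCycle_of_choice p
    (fun v => (hD.isOrientation.adj_iff _ _).2 (Or.inl (hp v)))
    fun v h => hD.isOrientation.asymm _ _ (hp v) (by simpa [h] using hp (p v))

/-- If the edges that leave `S` all end at `t`, then each component of the graph induced on `S`
has a neighbour of `t`. -/
lemma exists_adj_of_component {V : Type*} {G : SimpleGraph V} (hG : G.Preconnected) {S : Set V}
    {t : V} (ht : t ∉ S) (hS : ∀ u ∈ S, ∀ v, G.Adj u v → v ∈ S ∨ v = t)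
    (c : (G.induce S).ConnectedComponent) : ∃ v ∈ c.supp, G.Adj t v := by
  by_contra! hcon
  obtain ⟨v₀, hv₀⟩ := c.nonempty_supp
  have := mem_of_adj_closed hG (S := Subtype.val '' c.supp) ?_ ⟨v₀, hv₀, rfl⟩ t
  · obtain ⟨v, _, rfl⟩ := this
    exact ht v.2
  · rintro _ ⟨u, hu, rfl⟩ v huv
    rcases hS u u.2 v huv with hv | rfl
    · exact ⟨⟨v, hv⟩, c.mem_supp_of_adj_mem_supp hu (by simpa using huv), rfl⟩
    · exact absurd huv.symm (hcon u hu)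

/-! ### Total domination numbers close to the order -/

/-- No two vertices can be left out of a total dominating set: for any two vertices some vertex
has all its in-neighbours among them. -/
def PairCritical {V : Type*} (D : Digraph V) : Prop :=
  ∀ p q, p ≠ q → ∃ v, ∀ u, D.Adj u v → u = p ∨ u = q

/-- The vertices other than `x` form a total dominating set. -/
def Dispensable {V : Type*} (D : Digraph V) (x : V) : Prop :=
  ∀ v, ∃ u, u ≠ x ∧ D.Adj u v

section

variable {V : Type*} {D : Digraph V}

lemma totalDominationNumber_le {S : Finset V} (hS : IsTotalDominatingSet D S) :
    totalDominationNumber D ≤ S.card :=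
  Nat.sInf_le ⟨S, hS, rfl⟩

variable [Fintype V]

lemma exists_card_eq_totalDominationNumber (hD : ∀ v, ∃ u, D.Adj u v) :
    ∃ S : Finset V, IsTotalDominatingSet D S ∧ S.card = totalDominationNumber D :=
  Nat.sInf_mem (s := {n | ∃ S : Finset V, IsTotalDominatingSet D S ∧ S.card = n})
    ⟨_, Finset.univ, fun v => (hD v).imp fun _ hu => ⟨Finset.mem_univ _, hu⟩, rfl⟩

lemma totalDominationNumber_lt_card_iff (hD : ∀ v, ∃ u, D.Adj u v) :
    totalDominationNumber D < Fintype.card V ↔ ∃ x, Dispensable D x := by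
  classical
  constructor
  · intro h
    obtain ⟨S, hS, hcard⟩ := exists_card_eq_totalDominationNumber hD
    obtain ⟨x, hx⟩ : ∃ x, x ∉ S := by
      by_contra! hall
      rw [← hcard, Finset.eq_univ_of_forall hall, Finset.card_univ] at h
      exact lt_irrefl _ h
    exact ⟨x, fun v => (hS v).imp fun u hu => ⟨fun e => hx (e ▸ hu.1), hu.2⟩⟩
  · rintro ⟨x, hx⟩
    have hS : IsTotalDominatingSet D ({x}ᶜ : Finset V) := fun v =>
      (hx v).imp fun u hu => ⟨by simpa using hu.1, hu.2⟩
    refine (totalDominationNumber_le hS).trans_lt ?_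
    rw [← Finset.card_univ]
    exact Finset.card_lt_card ((Finset.ssubset_univ_iff).2 fun h => by
      have := Finset.mem_univ x
      rw [← h] at this
      simp at this)

lemma card_le_totalDominationNumber_add_one_iff (hD : ∀ v, ∃ u, D.Adj u v) :
    Fintype.card V ≤ totalDominationNumber D + 1 ↔ PairCritical D := by
  classical
  constructor
  · intro h p q hpq
    by_contra! hcon
    have hS : IsTotalDominatingSet D ({p, q}ᶜ : Finset V) := fun v =>
      (hcon v).imp fun u hu => ⟨by simpa using hu.2, hu.1⟩
    have h1 := totalDominationNumber_le hS
    have h2 := Finset.card_add_card_compl ({p, q} : Finset V)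
    rw [Finset.card_pair hpq] at h2
    omega
  · intro h
    obtain ⟨S, hS, hcard⟩ := exists_card_eq_totalDominationNumber hD
    by_contra! hlt
    have h2 := Finset.card_add_card_compl S
    obtain ⟨p, hp, q, hq, hpq⟩ := Finset.one_lt_card.1 (show 1 < Sᶜ.card by omega)
    obtain ⟨v, hv⟩ := h p q hpq
    obtain ⟨u, hu, huv⟩ := hS v
    rcases hv u huv with rfl | rfl
    · exact (Finset.mem_compl.1 hp) hu
    · exact (Finset.mem_compl.1 hq) hu

lemma totalDominationNumber_le_card (hD : ∀ v, ∃ u, D.Adj u v) :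
    totalDominationNumber D ≤ Fintype.card V := by
  obtain ⟨S, _, hcard⟩ := exists_card_eq_totalDominationNumber hD
  exact hcard ▸ Finset.card_le_univ S

variable {G : SimpleGraph V}

lemma upperOrientableTotalDominationNumber_add_one_eq (hD : IsValidOrientation D G)
    (hcrit : PairCritical D)
    (hdisp : ∀ D' : Digraph V, IsValidOrientation D' G → ∃ x, Dispensable D' x) :
    upperOrientableTotalDominationNumber G + 1 = Fintype.card V := by
  have hlt : ∀ D' : Digraph V, IsValidOrientation D' G →
      totalDominationNumber D' < Fintype.card V := fun D' hD' =>
    (totalDominationNumber_lt_card_iff hD'.in_pos).2 (hdisp D' hD')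
  have hD1 : totalDominationNumber D + 1 = Fintype.card V :=
    le_antisymm (hlt D hD) ((card_le_totalDominationNumber_add_one_iff hD.in_pos).2 hcrit)
  have : IsGreatest {n | ∃ D : Digraph V, IsValidOrientation D G ∧ totalDominationNumber D = n}
      (totalDominationNumber D) := by
    refine ⟨⟨D, hD, rfl⟩, ?_⟩
    rintro _ ⟨D', hD', rfl⟩
    have := hlt D' hD'
    omega
  rw [upperOrientableTotalDominationNumber, this.csSup_eq, hD1]

/-- If `DOM_t(G) = |V(G)| - 1`, then some valid orientation attains this value. Without valid
orientations the supremum would be `0`, and `G` would have a single vertex and no cycle. -/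
lemma exists_pairCritical (hG : EveryComponentHasCycle G)
    (h : upperOrientableTotalDominationNumber G + 1 = Fintype.card V) :
    ∃ D : Digraph V, IsValidOrientation D G ∧ PairCritical D ∧ ∃ x, Dispensable D x := by
  have hne : {n | ∃ D : Digraph V, IsValidOrientation D G ∧
      totalDominationNumber D = n}.Nonempty := by
    by_contra hemp
    rw [upperOrientableTotalDominationNumber, Set.not_nonempty_iff_eq_empty.1 hemp,
      csSup_empty, bot_eq_zero, zero_add] at h
    obtain ⟨v₀, hv₀⟩ := Fintype.card_eq_one_iff.1 h.symm
    obtain ⟨v, _, p, hp⟩ := hG (G.connectedComponentMk v₀)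
    have hadj := p.adj_snd hp.not_nil
    exact hadj.ne ((hv₀ _).trans (hv₀ _).symm)
  obtain ⟨D, hD, hDn⟩ := Nat.sSup_mem hne ⟨Fintype.card V, by
    rintro _ ⟨D', hD', rfl⟩
    exact totalDominationNumber_le_card hD'.in_pos⟩
  rw [← upperOrientableTotalDominationNumber] at hDn
  refine ⟨D, hD, (card_le_totalDominationNumber_add_one_iff hD.in_pos).1 (by omega),
    (totalDominationNumber_lt_card_iff hD.in_pos).1 (by omega)⟩

end

/-- If no vertex is dispensable, then each vertex is the only in-neighbour of some vertex. By
counting, all in-degrees and out-degrees are one. -/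
lemma exists_perm_of_forall_not_dispensable {V : Type*} [Finite V] {D : Digraph V}
    (hin : ∀ v, ∃ u, D.Adj u v) (hD : ∀ x, ¬ Dispensable D x) :
    ∃ σ : Perm V, ∀ u v, D.Adj u v ↔ v = σ u := by
  simp only [Dispensable, not_forall, not_exists, not_and] at hD
  choose g hg using hD
  have hg' : ∀ x u, D.Adj u (g x) → u = x := fun x u h => by
    by_contra hne
    exact hg x u hne h
  have hadj : ∀ x, D.Adj x (g x) := fun x => by
    obtain ⟨u, hu⟩ := hin (g x)
    exact hg' x u hu ▸ hu
  have hinj : Injective g := fun x y hxy => hg' y x (hxy ▸ hadj x)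
  refine ⟨Equiv.ofBijective g (Finite.injective_iff_bijective.1 hinj), fun u v => ?_⟩
  simp only [Equiv.ofBijective_apply]
  refine ⟨fun h => ?_, fun h => h ▸ hadj u⟩
  obtain ⟨x, rfl⟩ := (Finite.injective_iff_bijective.1 hinj).2 v
  rw [hg' x u h]

/-! ### Spines and their orientations -/

/-- The permutation `σ` exhibits `R` as a path from `σ s` to `s` together with disjoint cycles, all
traversed in the direction of `σ`, and further edges at `σ s`, of which there is at least one. The
path is the cycle of `σ` through `s` without its arc from `s` to `σ s`; it consists of the vertex
`s` alone if `σ s = s`. -/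
structure IsSpine {V : Type*} (R : SimpleGraph V) (σ : Perm V) (s : V) : Prop where
  adj : ∀ v, v ≠ s → R.Adj v (σ v)
  asymm : ∀ v, v ≠ s → σ v ≠ s → σ (σ v) ≠ v
  cases_of_adj : ∀ u v, R.Adj u v → v = σ u ∨ u = σ v ∨ u = σ s ∨ v = σ s
  extra : ∃ x, x ≠ s ∧ x ≠ σ (σ s) ∧ R.Adj x (σ s)

/-- The orientation of `R`, extended by the edges between `s` and the set `E`, that follows `σ`,
directs all further edges of `R` towards `σ s`, and directs the added edges away from `s`. -/
def spineDigraph {V : Type*} (R : SimpleGraph V) (σ : Perm V) (s : V) (E : Set V) :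
    Digraph V where
  Adj u v := (u ≠ s ∧ v = σ u) ∨ (v = σ s ∧ R.Adj u v ∧ u ≠ σ v) ∨ (u = s ∧ v ∈ E)

section

variable {V : Type*} {R G : SimpleGraph V} {σ : Perm V} {s : V} {E : Set V}

lemma IsSpine.isValidOrientation (h : IsSpine R σ s)
    (hE : ∀ e ∈ E, e ≠ s ∧ ¬ R.Adj s e)
    (hG : ∀ u v, G.Adj u v ↔ R.Adj u v ∨ (u = s ∧ v ∈ E) ∨ (v = s ∧ u ∈ E)) :
    IsValidOrientation (spineDigraph R σ s E) G := by
  refine ⟨⟨fun u v => ?_, fun u v => ?_⟩, fun v => ?_⟩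
  · rw [hG]
    constructor
    · have along : ∀ u v, R.Adj u v → v = σ u →
          (spineDigraph R σ s E).Adj u v ∨ (spineDigraph R σ s E).Adj v u := by
        intro u v hR hv
        by_cases hu : u = s
        · by_cases hv' : u = σ v
          · exact Or.inr (Or.inl ⟨hu ▸ hR.ne', hv'⟩)
          · exact Or.inl (Or.inr (Or.inl ⟨hu ▸ hv, hR, hv'⟩))
        · exact Or.inl (Or.inl ⟨hu, hv⟩)
      have toward : ∀ u v, R.Adj u v → v = σ s →
          (spineDigraph R σ s E).Adj u v ∨ (spineDigraph R σ s E).Adj v u := by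
        intro u v hR hv
        by_cases hu : u = σ v
        · exact (along v u hR.symm hu).symm
        · exact Or.inl (Or.inr (Or.inl ⟨hv, hR, hu⟩))
      rintro (hR | hR | hR)
      · rcases h.cases_of_adj u v hR with h1 | h1 | h1 | h1
        · exact along u v hR h1
        · exact (along v u hR.symm h1).symm
        · exact (toward v u hR.symm h1).symm
        · exact toward u v hR h1
      · exact Or.inl (Or.inr (Or.inr hR))
      · exact Or.inr (Or.inr (Or.inr hR))
    · rintro ((⟨hu, rfl⟩ | hR | hR) | (⟨hu, rfl⟩ | hR | hR))
      · exact Or.inl (h.adj u hu)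
      · exact Or.inl hR.2.1
      · exact Or.inr (Or.inl hR)
      · exact Or.inl (h.adj v hu).symm
      · exact Or.inl hR.2.1.symm
      · exact Or.inr (Or.inr hR)
  · simp only [spineDigraph]
    have has := h.asymm
    have hEu := hE u
    have hEv := hE v
    have hRu := h.adj u
    have hRv := h.adj v
    rintro (⟨hu, hv⟩ | ⟨hv, hR, hu⟩ | ⟨hu, hv⟩) (⟨hu', hv'⟩ | ⟨hv', hR', hu'⟩ | ⟨hu', hv'⟩)
    · exact has u hu (hv ▸ hu') (by rw [← hv, ← hv'])
    · exact hu' hv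
    · subst hu'
      exact (hEu hv').2 (by simpa [← hv] using (hRu hu).symm)
    · exact hu hv'
    · exact hR.ne (hv'.trans hv.symm)
    · subst hu'
      exact (hEu hv').2 hR.symm
    · subst hu
      exact (hEv hv).2 (by simpa [← hv'] using (hRv hu').symm)
    · subst hu
      exact (hEv hv).2 hR'.symm
    · exact (hEu hv').1 hu
  · by_cases hv : v = σ s
    · obtain ⟨x, -, hx, hR⟩ := h.extra
      exact ⟨x, Or.inr (Or.inl ⟨hv, hv ▸ hR, hv ▸ hx⟩)⟩
    · refine ⟨σ.symm v, Or.inl ⟨fun e => hv ?_, by simp⟩⟩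
      rw [← e, σ.apply_symm_apply]

/-- A set missing two vertices `p` and `q` other than `s` can dominate `σ p` and `σ q` only if both
of them have `s` as a second in-neighbour. By hypothesis it then does not dominate `σ s`. -/
lemma pairCritical_spineDigraph
    (H : ∀ p q, p ≠ q → p ≠ s → q ≠ s → σ p ∈ E → σ q ∈ E →
      σ s ∉ E ∧ ∀ u, R.Adj u (σ s) → u ≠ σ (σ s) → u = p ∨ u = q) :
    PairCritical (spineDigraph R σ s E) := by
  have key : ∀ p, p ≠ s → ∀ u, (spineDigraph R σ s E).Adj u (σ p) →
      u = p ∨ (u = s ∧ σ p ∈ E) := by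
    rintro p hp u (⟨_, hv⟩ | ⟨hv, _⟩ | hu)
    · exact Or.inl (σ.injective hv).symm
    · exact absurd (σ.injective hv) hp
    · exact Or.inr hu
  intro p q hpq
  by_cases hp : p = s
  · exact ⟨σ q, fun u hu => (key q (fun e => hpq (hp.trans e.symm)) u hu).elim Or.inr
      fun hu => Or.inl (hu.1.trans hp.symm)⟩
  by_cases hq : q = s
  · exact ⟨σ p, fun u hu => (key p hp u hu).elim Or.inl fun hu => Or.inr (hu.1.trans hq.symm)⟩
  by_cases hpE : σ p ∈ E
  · by_cases hqE : σ q ∈ E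
    · obtain ⟨hs, ht⟩ := H p q hpq hp hq hpE hqE
      refine ⟨σ s, ?_⟩
      rintro u (⟨hu, hv⟩ | ⟨_, hR, hu⟩ | ⟨_, hE⟩)
      · exact absurd (σ.injective hv).symm hu
      · exact ht u hR hu
      · exact absurd hE hs
    · exact ⟨σ q, fun u hu => Or.inr ((key q hq u hu).resolve_right fun h => hqE h.2)⟩
  · exact ⟨σ p, fun u hu => Or.inl ((key p hp u hu).resolve_right fun h => hpE h.2)⟩

/-- A vertex joined to `σ s` by an extra edge has at least three neighbours, so no orientation of
the graph consists of directed cycles. -/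
lemma IsSpine.exists_dispensable [Finite V] (h : IsSpine R σ s) (hRG : R ≤ G) {D : Digraph V}
    (hD : IsValidOrientation D G) : ∃ x, Dispensable D x := by
  by_contra! hcon
  obtain ⟨τ, hτ⟩ := exists_perm_of_forall_not_dispensable hD.in_pos hcon
  have hnb : ∀ u v, R.Adj u v → v = τ u ∨ u = τ v := fun u v huv => by
    have := (hD.isOrientation.adj_iff u v).1 (hRG huv)
    rwa [hτ, hτ] at this
  obtain ⟨x, hxs, hx, hR⟩ := h.extra
  have e1 : σ (σ.symm x) = x := σ.apply_symm_apply x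
  have hys : σ.symm x ≠ s := fun e => hR.ne (by rw [← e, e1])
  have h1 := hnb _ _ hR
  have h2 := hnb _ _ (h.adj x hxs)
  have h3 := hnb _ _ (h.adj _ hys)
  have a := h.asymm (σ.symm x) hys (by rwa [e1])
  rw [e1] at h3 a
  have b : σ s ≠ σ x := fun e => hxs (σ.injective e).symm
  have c : σ s ≠ σ.symm x := fun e => hx (by rw [e, e1])
  have i := τ.injective
  rcases h1 with h1 | h1 <;> rcases h2 with h2 | h2 <;> rcases h3 with h3 | h3 <;>
    grind [i.eq_iff]

lemma IsSpine.upperOrientableTotalDominationNumber_add_one [Fintype V] (h : IsSpine R σ s)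
    (hE : ∀ e ∈ E, e ≠ s ∧ ¬ R.Adj s e)
    (hG : ∀ u v, G.Adj u v ↔ R.Adj u v ∨ (u = s ∧ v ∈ E) ∨ (v = s ∧ u ∈ E))
    (H : ∀ p q, p ≠ q → p ≠ s → q ≠ s → σ p ∈ E → σ q ∈ E →
      σ s ∉ E ∧ ∀ u, R.Adj u (σ s) → u ≠ σ (σ s) → u = p ∨ u = q) :
    upperOrientableTotalDominationNumber G + 1 = Fintype.card V :=
  upperOrientableTotalDominationNumber_add_one_eq (h.isValidOrientation hE hG)
    (pairCritical_spineDigraph H) fun _ hD' =>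
      h.exists_dispensable (fun u v huv => (hG u v).2 (Or.inl huv)) hD'

end

/-! ### Spines of the graphs in the families -/

lemma exists_perm_extend {V : Type*} [Finite V] {s : V} (h : V → V)
    (hinj : Set.InjOn h {s}ᶜ) : ∃ σ : Perm V, ∀ v, v ≠ s → σ v = h v := by
  classical
  have := Fintype.ofFinite V
  obtain ⟨g, hg⟩ := Set.MapsTo.exists_equiv_extend_of_card_eq (t := (Finset.univ : Finset V))
    (by simp) (s := {s}ᶜ) (f := h) (fun _ _ => by simp) hinj
  exact ⟨g.trans (Equiv.subtypeUnivEquiv fun x => Finset.mem_univ x), fun v hv => hg v hv⟩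

section

variable {V : Type*} [Finite V] {R : SimpleGraph V} {k : ℕ} {w : ℕ → V}

/-- The permutation that walks back along the path, from `w k` to `w 0`, and goes around the cycles
in the directions given by `D`. -/
lemma IsF1Path.exists_isSpine (h : IsF1Path R k w)
    {D : Digraph ↥((pathVertices k w)ᶜ)} (hD : IsValidOrientation D (offPath R k w)) :
    ∃ σ : Perm V, IsSpine R σ (w 0) ∧ σ (w 0) = w k ∧ (∀ i < k, σ (w (i + 1)) = w i) ∧
      ∀ x a, D.Adj x a → σ x = a := by
  classical
  obtain ⟨τ, hτ⟩ := h.cycles.exists_perm_of_orientation hD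
  let idx : V → ℕ := invFunOn w (Set.Iic k)
  have hidx : ∀ i ≤ k, idx (w i) = i := fun i hi =>
    h.injOn.leftInvOn_invFunOn (Set.mem_Iic.2 hi)
  let f : V → V := fun v => if hv : v ∈ (pathVertices k w)ᶜ then τ ⟨v, hv⟩ else w (idx v - 1)
  have hon : ∀ i ≤ k, w i ∈ pathVertices k w := fun i hi => ⟨i, hi, rfl⟩
  have hfon : ∀ i < k, f (w (i + 1)) = w i := by
    intro i hi
    simp only [f]
    rw [dif_neg (by simpa using hon (i + 1) hi), hidx _ hi]
    rfl
  have hfoff : ∀ v : ↥((pathVertices k w)ᶜ), f v = τ v := fun v => dif_pos v.2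
  have hcases : ∀ v, v ≠ w 0 →
      (∃ i < k, v = w (i + 1)) ∨ ∃ x : ↥((pathVertices k w)ᶜ), v = x := by
    intro v hv
    by_cases hp : v ∈ pathVertices k w
    · obtain ⟨i, hi, rfl⟩ := hp
      obtain _ | i := i
      · exact absurd rfl hv
      · exact Or.inl ⟨i, hi, rfl⟩
    · exact Or.inr ⟨⟨v, hp⟩, rfl⟩
  have hinj : Set.InjOn f {w 0}ᶜ := by
    intro u hu v hv huv
    rcases hcases u hu with ⟨i, hi, rfl⟩ | ⟨x, rfl⟩ <;>
      rcases hcases v hv with ⟨j, hj, rfl⟩ | ⟨y, rfl⟩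
    · rw [hfon i hi, hfon j hj] at huv
      rw [h.injOn hi.le hj.le huv]
    · rw [hfon i hi, hfoff] at huv
      exact absurd (huv ▸ hon i hi.le) (τ y).2
    · rw [hfon j hj, hfoff] at huv
      exact absurd (huv ▸ hon j hj.le) (τ x).2
    · rw [hfoff, hfoff] at huv
      rw [τ.injective (Subtype.ext huv)]
  obtain ⟨σ, hσ⟩ := exists_perm_extend f hinj
  have hw : ∀ i < k, w (i + 1) ≠ w 0 := fun i hi e => by
    have := h.injOn (Set.mem_Iic.2 hi) (Set.mem_Iic.2 (Nat.zero_le k)) e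
    omega
  have hoff : ∀ x : ↥((pathVertices k w)ᶜ), (x : V) ≠ w 0 := fun x e =>
    x.2 (e ▸ hon 0 (Nat.zero_le k))
  have hσon : ∀ i < k, σ (w (i + 1)) = w i := fun i hi => (hσ _ (hw i hi)).trans (hfon i hi)
  have hσoff : ∀ x : ↥((pathVertices k w)ᶜ), σ x = τ x := fun x =>
    (hσ _ (hoff x)).trans (hfoff x)
  have hlast : σ (w 0) = w k := by
    have : σ.symm (w k) = w 0 := by
      by_contra hne
      rcases hcases _ hne with ⟨i, hi, hv⟩ | ⟨x, hv⟩
      · have e := hσon i hi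
        rw [← hv, σ.apply_symm_apply] at e
        have := h.injOn (Set.mem_Iic.2 le_rfl) (Set.mem_Iic.2 hi.le) e
        omega
      · have e := hσoff x
        rw [← hv, σ.apply_symm_apply] at e
        exact (τ x).2 (e ▸ hon k le_rfl)
    rw [← this, σ.apply_symm_apply]
  refine ⟨σ, ⟨?_, ?_, ?_, ?_⟩, hlast, hσon, ?_⟩
  · intro v hv
    rcases hcases v hv with ⟨i, hi, rfl⟩ | ⟨x, rfl⟩
    · rw [hσon i hi]
      exact (h.path_adj i hi).symm
    · rw [hσoff]
      exact (hD.isOrientation.adj_iff x (τ x)).2 (Or.inl ((hτ _ _).2 rfl))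
  · intro v hv hv' e
    rcases hcases v hv with ⟨i, hi, rfl⟩ | ⟨x, rfl⟩
    · rw [hσon i hi] at hv' e
      obtain _ | i := i
      · exact hv' rfl
      · rw [hσon i (by omega)] at e
        have := h.injOn (Set.mem_Iic.2 (by omega)) (Set.mem_Iic.2 (by omega)) e
        omega
    · rw [hσoff, hσoff] at e
      exact hD.isOrientation.asymm x (τ x) ((hτ _ _).2 rfl) ((hτ _ _).2 (Subtype.ext e.symm))
  · intro u v huv
    rcases h.edges u v huv with ⟨i, hi, e⟩ | ⟨hu, hv⟩ | hu | hv
    · rcases Sym2.eq_iff.1 e with ⟨rfl, rfl⟩ | ⟨rfl, rfl⟩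
      · exact Or.inr (Or.inl (hσon i hi).symm)
      · exact Or.inl (hσon i hi).symm
    · have := (hD.isOrientation.adj_iff ⟨u, hu⟩ ⟨v, hv⟩).1 huv
      rw [hτ, hτ, Subtype.ext_iff, Subtype.ext_iff, ← hσoff, ← hσoff] at this
      tauto
    · exact Or.inr (Or.inr (Or.inl (hu.trans hlast.symm)))
    · exact Or.inr (Or.inr (Or.inr (hv.trans hlast.symm)))
  · obtain ⟨k, rfl⟩ : ∃ k', k = k' + 1 := ⟨k - 1, by have := h.one_le_length; omega⟩
    rw [hlast, hσon k (by omega)]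
    obtain ⟨x, hx, hne⟩ := Set.exists_ne_of_one_lt_ncard h.two_le_deg (w k)
    refine ⟨x, ?_, hne, hx.symm⟩
    rintro rfl
    obtain ⟨y, hy⟩ := Set.ncard_eq_one.1 ((h.deg_eq_one_iff (w 0)).2 rfl)
    have h1 : w 1 ∈ R.neighborSet (w 0) := h.path_adj 0 (by omega)
    have h2 : w (k + 1) ∈ R.neighborSet (w 0) := hx.symm
    rw [hy] at h1 h2
    have := h.injOn (Set.mem_Iic.2 (by omega)) (Set.mem_Iic.2 le_rfl) (h1.trans h2.symm)
    obtain rfl : k = 0 := by omega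
    exact hne rfl
  · intro x a hxa
    rw [hσoff, ← (hτ x a).1 hxa]

end

section

variable {V : Type*} [Fintype V] {G : SimpleGraph V}

lemma InF1.upperOrientableTotalDominationNumber_add_one (hG : InF1 G) :
    upperOrientableTotalDominationNumber G + 1 = Fintype.card V := by
  obtain ⟨-, -, k, w, h⟩ := hG
  obtain ⟨D, hD⟩ := h.cycles.exists_validOrientation
  obtain ⟨σ, hσ, -⟩ := h.exists_isSpine hD
  exact hσ.upperOrientableTotalDominationNumber_add_one (E := ∅) (by simp) (by simp) (by simp)

lemma InF2.upperOrientableTotalDominationNumber_add_one (hG : InF2 G) :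
    upperOrientableTotalDominationNumber G + 1 = Fintype.card V := by
  obtain ⟨-, -, -, s, -, hc, -, hs⟩ := hG
  obtain ⟨τ, hτ, hτ2⟩ := hc.exists_perm
  classical
  let σ : Perm V := τ.ofSubtype
  have hσ : ∀ x : ({s}ᶜ : Set V), σ x = τ x := fun x => Equiv.Perm.ofSubtype_apply_coe τ x
  have hσs : σ s = s := Equiv.Perm.ofSubtype_apply_of_not_mem τ (by simp)
  have hadj : ∀ u v (hu : u ≠ s) (hv : v ≠ s), G.Adj u v ↔ v = σ u ∨ u = σ v := by
    intro u v hu hv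
    have := hτ ⟨u, hu⟩ ⟨v, hv⟩
    rwa [Subtype.ext_iff, Subtype.ext_iff, ← hσ, ← hσ] at this
  have hne : ∀ v, v ≠ s → σ v ≠ s := fun v hv e => hv (σ.injective (e.trans hσs.symm))
  have hspine : IsSpine G σ s := by
    refine ⟨fun v hv => (hadj v _ hv (hne v hv)).2 (Or.inl rfl), fun v hv _ e => ?_, ?_, ?_⟩
    · rw [hσ ⟨v, hv⟩, hσ] at e
      exact hτ2 ⟨v, hv⟩ (Subtype.ext e)
    · intro u v huv
      rw [hσs]
      by_cases hu : u = s
      · tauto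
      by_cases hv : v = s
      · tauto
      have := (hadj u v hu hv).1 huv
      tauto
    · obtain ⟨x, hx, hxs⟩ := Set.exists_ne_of_one_lt_ncard hs s
      exact ⟨x, hxs, by rwa [hσs, hσs], by rw [hσs]; exact hx.symm⟩
  exact hspine.upperOrientableTotalDominationNumber_add_one (E := ∅) (by simp) (by simp) (by simp)

end

section

variable {V : Type*} [Finite V] {R : SimpleGraph V} {σ : Perm V} {s : V}

/-- A vertex of degree three has a neighbour besides its two neighbours along `σ`. -/
lemma IsSpine.adj_of_deg_eq_three (h : IsSpine R σ s) {x : V} (hx : deg R x = 3)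
    (hxt : x ≠ σ s) : R.Adj x (σ s) ∧ x ≠ σ (σ s) := by
  by_contra hcon
  have hsub : R.neighborSet x ⊆ {σ x, σ.symm x} := by
    intro v hv
    have e : ∀ y, x = σ y ↔ y = σ.symm x := fun y => by
      rw [Equiv.eq_symm_apply]; exact eq_comm
    rcases h.cases_of_adj x v hv with h1 | h1 | h1 | rfl
    · exact Or.inl h1
    · exact Or.inr ((e v).1 h1)
    · exact absurd h1 hxt
    · exact Or.inr ((e _).1 (by tauto))
  have := Set.ncard_le_ncard hsub
  have h2 := Set.ncard_insert_le (σ x) {σ.symm x}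
  rw [Set.ncard_singleton] at h2
  rw [deg] at hx
  omega

/-- If `t = σ s` has degree two, then the end of its extra edge is determined. -/
lemma IsSpine.eq_of_deg_eq_two (h : IsSpine R σ s) (hs : σ s ≠ s) (ht : deg R (σ s) = 2)
    {x : V} (hx : R.Adj x (σ s)) (hx' : x ≠ σ (σ s)) {u : V} (hu : R.Adj u (σ s))
    (hu' : u ≠ σ (σ s)) : u = x := by
  by_contra hne
  have hsub : ({σ (σ s), x, u} : Set V) ⊆ R.neighborSet (σ s) := by
    rintro v (rfl | rfl | rfl)
    · exact h.adj _ hs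
    · exact hx.symm
    · exact hu.symm
  have := Set.ncard_le_ncard hsub
  have h3 := Set.ncard_eq_three.2 ⟨_, _, _, hx'.symm, hu'.symm, Ne.symm hne, rfl⟩
  rw [deg] at ht
  omega

/-- If `t = σ s` has degree three, then the ends of its two extra edges are determined. -/
lemma IsSpine.eq_or_eq_of_deg_eq_three (h : IsSpine R σ s) (hs : σ s ≠ s)
    (ht : deg R (σ s) = 3) {x y : V} (hxy : x ≠ y) (hx : R.Adj x (σ s)) (hx' : x ≠ σ (σ s))
    (hy : R.Adj y (σ s)) (hy' : y ≠ σ (σ s)) {u : V} (hu : R.Adj u (σ s))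
    (hu' : u ≠ σ (σ s)) : u = x ∨ u = y := by
  by_contra! hne
  have hsub : insert u ({σ (σ s), x, y} : Set V) ⊆ R.neighborSet (σ s) := by
    rintro v (rfl | rfl | rfl | rfl)
    · exact hu.symm
    · exact h.adj _ hs
    · exact hx.symm
    · exact hy.symm
  have := Set.ncard_le_ncard hsub
  rw [Set.ncard_insert_of_notMem (by simp; tauto),
    Set.ncard_eq_three.2 ⟨_, _, _, hx'.symm, hy'.symm, hxy, rfl⟩] at this
  rw [deg] at ht
  omega

/-- The partner of `x` is its successor under `σ`, and `x` is an end of an extra edge. -/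
lemma IsPartner.spine {k : ℕ} {w : ℕ → V} {D : Digraph ↥((pathVertices k w)ᶜ)} {x a : V}
    (hp : IsPartner R k w D x a) (hw : Set.InjOn w (Set.Iic k)) (hspine : IsSpine R σ (w 0))
    (hlast : σ (w 0) = w k) (hon : ∀ i < k, σ (w (i + 1)) = w i)
    (hoff : ∀ x a, D.Adj x a → σ x = a) :
    σ x = a ∧ x ≠ w 0 ∧ R.Adj x (σ (w 0)) ∧ x ≠ σ (σ (w 0)) := by
  have h3 := hspine.adj_of_deg_eq_three hp.deg_eq (hlast ▸ hp.ne_last)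
  rcases hp.follows with ⟨i, hi, rfl, rfl⟩ | ⟨hx, ha, hxa⟩
  · refine ⟨hon i (by omega), fun e => ?_, h3⟩
    have := hw (Set.mem_Iic.2 hi.le) (Set.mem_Iic.2 (Nat.zero_le k)) e
    omega
  · exact ⟨hoff _ _ hxa, fun e => hx ⟨0, Nat.zero_le k, e.symm⟩, h3⟩

end

lemma InF3.upperOrientableTotalDominationNumber_add_one {V : Type*} [Fintype V] {G : SimpleGraph V}
    (hG : InF3 G) : upperOrientableTotalDominationNumber G + 1 = Fintype.card V := by
  obtain ⟨-, -, R, -, k, w, h, hR⟩ := hG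
  have ht : ∀ σ : Perm V, σ (w 0) = w k → σ (w 0) ≠ w 0 := fun σ hlast e => by
    have := h.injOn (Set.mem_Iic.2 le_rfl) (Set.mem_Iic.2 (Nat.zero_le k)) (hlast ▸ e)
    have := h.one_le_length
    omega
  obtain ⟨a, ha, hsa, rfl⟩ | ⟨a, b, hab, ha, hb, hsa, hsb, hcond, rfl⟩ := hR
  · obtain ⟨D, hD⟩ := h.cycles.exists_validOrientation
    obtain ⟨σ, hσ, -⟩ := h.exists_isSpine hD
    refine hσ.upperOrientableTotalDominationNumber_add_one (E := {a}) (by simp [ha, hsa]) ?_ ?_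
    · intro u v
      rw [SimpleGraph.sup_adj, SimpleGraph.edge_adj]
      have := R.ne_of_adj (a := u) (b := v)
      grind
    · intro p q hpq _ _ hp hq
      exact absurd (σ.injective (hp.trans hq.symm)) hpq
  · have hadj : ∀ u v, (R ⊔ SimpleGraph.edge (w 0) a ⊔ SimpleGraph.edge (w 0) b).Adj u v ↔
        R.Adj u v ∨ (u = w 0 ∧ v ∈ ({a, b} : Set V)) ∨ (v = w 0 ∧ u ∈ ({a, b} : Set V)) := by
      intro u v
      rw [SimpleGraph.sup_adj, SimpleGraph.sup_adj, SimpleGraph.edge_adj, SimpleGraph.edge_adj]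
      grind
    -- an added edge at `σ (w 0)` does not change the in-neighbours of any other vertex
    have hlastedge : 1 < k ∧ a = w k → upperOrientableTotalDominationNumber
        (R ⊔ SimpleGraph.edge (w 0) a ⊔ SimpleGraph.edge (w 0) b) + 1 = Fintype.card V := by
      intro ha'
      obtain ⟨D, hD⟩ := h.cycles.exists_validOrientation
      obtain ⟨σ, hσ, hlast, -⟩ := h.exists_isSpine hD
      refine hσ.upperOrientableTotalDominationNumber_add_one (E := {a, b})
        (by simp [ha, hsa, hb, hsb]) hadj ?_
      intro p q hpq hps hqs hp hq
      have hna : ∀ p, p ≠ w 0 → σ p ≠ a := fun p hp e =>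
        hp (σ.injective (e.trans (ha'.2.trans hlast.symm)))
      have hp' := hp.resolve_left (hna p hps)
      have hq' := hq.resolve_left (hna q hqs)
      exact absurd (σ.injective (hp'.trans hq'.symm)) hpq
    rcases hcond with ⟨-, ha'⟩ | ⟨hdeg, ha' | ⟨D, hD, x, y, hxy, hx, hy⟩⟩ |
      ⟨hdeg, ha' | ⟨D, hD, x, hx⟩⟩
    · exact hlastedge ha'
    · exact hlastedge ha'
    · obtain ⟨σ, hσ, hlast, hon, hoff⟩ := h.exists_isSpine hD
      obtain ⟨rfl, hxs, hx1, hx2⟩ := hx.spine h.injOn hσ hlast hon hoff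
      obtain ⟨rfl, hys, hy1, hy2⟩ := hy.spine h.injOn hσ hlast hon hoff
      refine hσ.upperOrientableTotalDominationNumber_add_one (E := {σ x, σ y})
        (by simp only [Set.mem_insert_iff, Set.mem_singleton_iff]; grind) hadj ?_
      intro p q hpq hps hqs hp hq
      simp only [Set.mem_insert_iff, Set.mem_singleton_iff, σ.injective.eq_iff] at hp hq ⊢
      refine ⟨by grind, fun u hu hu' => ?_⟩
      have := hσ.eq_or_eq_of_deg_eq_three (ht σ hlast) (hlast ▸ hdeg) hxy hx1 hx2 hy1 hy2 hu hu'
      grind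
    · exact hlastedge ha'
    · obtain ⟨σ, hσ, hlast, hon, hoff⟩ := h.exists_isSpine hD
      obtain ⟨rfl, hxs, hx1, hx2⟩ := hx.spine h.injOn hσ hlast hon hoff
      refine hσ.upperOrientableTotalDominationNumber_add_one (E := {σ x, b})
        (by simp only [Set.mem_insert_iff, Set.mem_singleton_iff]; grind) hadj ?_
      intro p q hpq hps hqs hp hq
      obtain ⟨b, rfl⟩ := σ.surjective b
      simp only [Set.mem_insert_iff, Set.mem_singleton_iff, σ.injective.eq_iff] at hp hq ⊢
      refine ⟨by grind, fun u hu hu' => ?_⟩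
      have := hσ.eq_of_deg_eq_two (ht σ hlast) (hlast ▸ hdeg) hx1 hx2 hu hu'
      grind

lemma InF.upperOrientableTotalDominationNumber_add_one {V : Type*} [Fintype V] {G : SimpleGraph V}
    (hG : InF G) : upperOrientableTotalDominationNumber G + 1 = Fintype.card V := by
  rcases hG with h | h | h
  · exact h.upperOrientableTotalDominationNumber_add_one
  · exact h.upperOrientableTotalDominationNumber_add_one
  · exact h.upperOrientableTotalDominationNumber_add_one

/-! ### Paths from spines -/

section

variable {V : Type*} {R : SimpleGraph V} {σ : Perm V} {s : V}

lemma IsSpine.symm_apply_ne (h : IsSpine R σ s) {v : V} (hv : v ≠ s) (hvt : v ≠ σ s) :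
    R.Adj (σ.symm v) v ∧ σ v ≠ σ.symm v := by
  have e : σ (σ.symm v) = v := σ.apply_symm_apply v
  have hne : σ.symm v ≠ s := fun e' => hvt (by rw [← e', e])
  have h1 := h.adj _ hne
  have h2 := h.asymm _ hne
  rw [e] at h1 h2
  exact ⟨h1, h2 hv⟩

lemma IsSpine.deg_eq_three (h : IsSpine R σ s) {x : V} (hxs : x ≠ s) (hx : R.Adj x (σ s))
    (hx' : x ≠ σ (σ s)) : deg R x = 3 := by
  obtain ⟨h1, h2⟩ := h.symm_apply_ne hxs hx.ne
  refine Set.ncard_eq_three.2 ⟨σ x, σ.symm x, σ s, h2, fun e => hxs (σ.injective e),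
    fun e => hx' ((Equiv.symm_apply_eq σ).1 e), ?_⟩
  ext v
  simp only [SimpleGraph.mem_neighborSet, Set.mem_insert_iff, Set.mem_singleton_iff]
  constructor
  · intro hv
    rcases h.cases_of_adj x v hv with h1 | h1 | h1 | h1
    · exact Or.inl h1
    · exact Or.inr (Or.inl ((Equiv.eq_symm_apply σ).2 h1.symm))
    · exact absurd h1 hx.ne
    · exact Or.inr (Or.inr h1)
  · rintro (rfl | rfl | rfl)
    · exact h.adj x hxs
    · exact h1.symm
    · exact hx

variable [Finite V]

lemma IsSpine.two_le_deg (h : IsSpine R σ s) {v : V} (hv : v ≠ s) : 2 ≤ deg R v := by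
  have key : ∀ x, R.Adj v x → σ v ≠ x → 2 ≤ deg R v := fun x hx hne => by
    rw [← Set.ncard_pair hne]
    refine Set.ncard_le_ncard ?_
    rintro y (rfl | rfl)
    · exact h.adj v hv
    · exact hx
  by_cases hvt : v = σ s
  · obtain ⟨x, -, hx, hR⟩ := h.extra
    exact key x (hvt ▸ hR.symm) (hvt ▸ hx.symm)
  · obtain ⟨h1, h2⟩ := h.symm_apply_ne hv hvt
    exact key _ h1.symm h2

/-- A connected spine whose vertex `s` has no neighbour besides the one on the path belongs to
`F₁`: the path consists of the vertices `s, σ⁻¹ s, σ⁻² s, …`. -/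
lemma IsSpine.exists_isF1Path (h : IsSpine R σ s) (hR : R.Preconnected) (hs : σ s ≠ s)
    (hleaf : ∀ v, R.Adj s v → σ v = s) :
    ∃ (k : ℕ) (w : ℕ → V), IsF1Path R k w ∧ w 0 = s ∧ w k = σ s ∧
      ∃ D, IsValidOrientation D (offPath R k w) ∧
        ∀ x, x ≠ s → R.Adj x (σ s) → x ≠ σ (σ s) → IsPartner R k w D x (σ x) := by
  let w : ℕ → V := fun i => σ.symm^[i] s
  have hpos := minimalPeriod_pos_of_mem_periodicPts (σ.symm.injective.mem_periodicPts s)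
  obtain ⟨k, hk⟩ : ∃ k, minimalPeriod σ.symm s = k + 1 :=
    ⟨_, (Nat.succ_pred_eq_of_pos hpos).symm⟩
  have hw0 : w 0 = s := rfl
  have hw : ∀ i, σ (w (i + 1)) = w i := fun i => by
    simp only [w]
    rw [iterate_succ_apply', σ.apply_symm_apply]
  have hwk1 : w (k + 1) = s := by
    have := isPeriodicPt_minimalPeriod σ.symm s
    rwa [hk] at this
  have hwk : w k = σ s := by rw [← hw k, hwk1]
  have hinj : Set.InjOn w (Set.Iic k) := fun i hi j hj hij => by
    refine iterate_injOn_Iio_minimalPeriod (f := σ.symm) (x := s) ?_ ?_ hij <;>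
    · simp only [Set.mem_Iic] at hi hj
      rw [hk, Set.mem_Iio]
      omega
  have hk1 : 1 ≤ k := by
    by_contra hlt
    obtain rfl : k = 0 := by omega
    exact hs hwk.symm
  have hon : ∀ i ≤ k, w i ∈ pathVertices k w := fun i hi => ⟨i, hi, rfl⟩
  have hne : ∀ i, i + 1 ≤ k → w (i + 1) ≠ s := fun i hi e => by
    have := hinj (Set.mem_Iic.2 hi) (Set.mem_Iic.2 (Nat.zero_le k)) e
    omega
  have hclosed : ∀ v, σ v ∈ pathVertices k w ↔ v ∈ pathVertices k w := by
    intro v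
    constructor
    · rintro ⟨i, hi, hv⟩
      rw [← hw i] at hv
      rw [← σ.injective hv]
      rcases (Set.mem_Iic.1 hi).lt_or_eq with hi | rfl
      · exact hon _ hi
      · exact hwk1 ▸ hon 0 (Nat.zero_le _)
    · rintro ⟨i, hi, rfl⟩
      obtain _ | i := i
      · exact (hwk : w k = σ (w 0)) ▸ hon k le_rfl
      · exact (hw i).symm ▸ hon i (by have := Set.mem_Iic.1 hi; omega)
  have hsoff : ∀ v, v ∉ pathVertices k w → v ≠ s := fun v hv e =>
    hv (e ▸ hon 0 (Nat.zero_le k))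
  have htoff : ∀ v, v ∉ pathVertices k w → v ≠ σ s := fun v hv e =>
    hv (e ▸ hwk ▸ hon k le_rfl)
  have hoffadj : ∀ u v, u ∉ pathVertices k w → v ∉ pathVertices k w →
      (R.Adj u v ↔ v = σ u ∨ u = σ v) := by
    intro u v hu hv
    constructor
    · intro huv
      rcases h.cases_of_adj u v huv with h1 | h1 | h1 | h1
      · exact Or.inl h1
      · exact Or.inr h1
      · exact absurd h1 (htoff u hu)
      · exact absurd h1 (htoff v hv)
    · rintro (rfl | rfl)
      · exact h.adj u (hsoff u hu)
      · exact (h.adj v (hsoff v hv)).symm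
  have hasymm : ∀ v, v ∉ pathVertices k w → σ (σ v) ≠ v := fun v hv =>
    h.asymm v (hsoff v hv) (hsoff _ (mt (hclosed v).1 hv))
  let D : Digraph ↥((pathVertices k w)ᶜ) := ⟨fun x a => (a : V) = σ x⟩
  let τ : Perm ↥((pathVertices k w)ᶜ) := σ.subtypePerm fun v => not_congr (hclosed v)
  have hτ : ∀ x : ↥((pathVertices k w)ᶜ), (τ x : V) = σ x := fun x => rfl
  have hcyc : IsDisjointUnionOfCycles (offPath R k w) := by
    refine isDisjointUnionOfCycles_of_perm τ (fun u v => ?_) fun u e => ?_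
    · rw [Subtype.ext_iff, Subtype.ext_iff, hτ, hτ]
      exact hoffadj u v u.2 v.2
    · exact hasymm u u.2 (by rw [← hτ, ← hτ, e])
  have hD : IsValidOrientation D (offPath R k w) := by
    refine ⟨⟨fun u v => hoffadj u v u.2 v.2, fun u v huv hvu => ?_⟩, fun v => ?_⟩
    · exact hasymm u u.2 (((congrArg σ huv).symm).trans hvu.symm)
    · exact ⟨τ.symm v, by
        change (v : V) = σ _
        rw [← hτ, τ.apply_symm_apply]⟩
  have hsnb : R.neighborSet s = {σ.symm s} := by
    ext v
    simp only [SimpleGraph.mem_neighborSet, Set.mem_singleton_iff]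
    constructor
    · intro hv
      exact (Equiv.eq_symm_apply σ).2 (hleaf v hv)
    · rintro rfl
      have : σ.symm s ≠ s := fun e => hs (by rw [← e, σ.apply_symm_apply, e])
      have := h.adj _ this
      rw [σ.apply_symm_apply] at this
      exact this.symm
  have hdegs : deg R s = 1 := Set.ncard_eq_one.2 ⟨_, hsnb⟩
  refine ⟨k, w, ⟨?_, ?_, hk1, hinj, ?_, hcyc, ?_, ?_, ?_⟩, hw0, hwk, D, hD, ?_⟩
  · intro v
    by_cases hv : v = s
    · rw [hv, hdegs]
    · have := h.two_le_deg hv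
      omega
  · intro v
    constructor
    · intro hv
      by_contra hvs
      have := h.two_le_deg hvs
      omega
    · rintro rfl
      exact hdegs
  · intro i hi
    have := h.adj _ (hne i hi)
    rw [hw] at this
    exact this.symm
  · have key : ∀ u v, v = σ u → (∃ i < k, s(u, v) = s(w i, w (i + 1))) ∨
        (u ∉ pathVertices k w ∧ v ∉ pathVertices k w) ∨ v = w k := by
      rintro u v rfl
      by_cases hu : u ∈ pathVertices k w
      · obtain ⟨i, hi, rfl⟩ := hu
        obtain _ | i := i
        · exact Or.inr (Or.inr hwk.symm)
        · exact Or.inl ⟨i, hi, by rw [hw, Sym2.eq_swap]⟩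
      · exact Or.inr (Or.inl ⟨hu, mt (hclosed u).1 hu⟩)
    intro u v huv
    rcases h.cases_of_adj u v huv with h1 | h1 | h1 | h1
    · exact (key u v h1).imp_right (Or.imp_right Or.inr)
    · rw [Sym2.eq_swap]
      exact (key v u h1).imp_right (Or.imp And.symm Or.inl)
    · exact Or.inr (Or.inr (Or.inl (h1.trans hwk.symm)))
    · exact Or.inr (Or.inr (Or.inr (h1.trans hwk.symm)))
  · refine exists_adj_of_component hR (fun hk' => hk' (hon k le_rfl)) ?_
    intro u hu v huv
    by_cases hv : v ∈ pathVertices k w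
    · right
      rcases h.cases_of_adj u v huv with rfl | rfl | h1 | h1
      · exact absurd ((hclosed u).1 hv) hu
      · exact absurd ((hclosed v).2 hv) hu
      · exact absurd h1 (htoff u hu)
      · exact h1.trans hwk.symm
    · exact Or.inl hv
  · exact h.two_le_deg (hwk ▸ hs)
  · intro x hxs hx hx'
    refine ⟨fun e => hx.ne (e.trans hwk), h.deg_eq_three hxs hx hx', ?_⟩
    by_cases hxp : x ∈ pathVertices k w
    · obtain ⟨i, hi, rfl⟩ := hxp
      obtain _ | i := i
      · exact absurd rfl hxs
      · refine Or.inl ⟨i, lt_of_le_of_ne hi fun e => hx.ne ?_, rfl, hw i⟩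
        rw [e, hwk]
    · exact Or.inr ⟨hxp, mt (hclosed x).1 hxp, rfl⟩

/-- The arc of `σ` that `R` may lack is replaced by the rest of its cycle. -/
lemma reachable_of_sameCycle (h : ∀ v, v ≠ s → R.Adj v (σ v)) {u v : V}
    (huv : σ.SameCycle u v) : R.Reachable u v := by
  have hts : R.Reachable (σ s) s := by
    have key : ∀ j : ℕ, R.Reachable (σ s) ((σ ^ j) (σ s)) ∨ R.Reachable (σ s) s := by
      intro j
      induction j with
      | zero => exact Or.inl (SimpleGraph.Reachable.refl _)
      | succ j ih =>
        rcases ih with ih | ih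
        · by_cases hj : (σ ^ j) (σ s) = s
          · rw [hj] at ih
            exact Or.inr ih
          · refine Or.inl (ih.trans ?_)
            rw [pow_succ', Perm.mul_apply]
            exact (h _ hj).reachable
        · exact Or.inr ih
    obtain ⟨j, hj⟩ := (Perm.sameCycle_apply_left.2 (Perm.SameCycle.refl σ s)).exists_nat_pow_eq
    rcases key j with h | h
    · rwa [hj] at h
    · exact h
  have hstep : ∀ v, R.Reachable v (σ v) := fun v => by
    by_cases hv : v = s
    · exact hv ▸ hts.symm
    · exact (h v hv).reachable
  obtain ⟨j, rfl⟩ := huv.exists_nat_pow_eq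
  clear huv
  induction j with
  | zero => exact SimpleGraph.Reachable.refl _
  | succ j ih =>
    rw [pow_succ', Perm.mul_apply]
    exact ih.trans (hstep _)

end

/-! ### Almost cyclic orientations -/

/-- The arcs `v → σ v`, where `v ≠ s`, belong to `D`, and besides them only the arcs towards `σ s`
and the arcs that leave `s` do. There is an arc towards `σ s` from a vertex other than `s`. -/
structure IsAlmostCyclic {V : Type*} (D : Digraph V) (σ : Perm V) (s : V) : Prop where
  adj : ∀ v, v ≠ s → D.Adj v (σ v)
  eq_or_eq : ∀ v, v ≠ s → ∀ u, D.Adj u (σ v) → u = v ∨ u = s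
  extra : ∃ x, x ≠ s ∧ D.Adj x (σ s)

/-- The digraph `D` without the arcs that leave `s`. -/
def dropOut {V : Type*} (D : Digraph V) (s : V) : Digraph V where
  Adj u v := u ≠ s ∧ D.Adj u v

/-- The graph that remains of the underlying graph of an oriented graph `D` when the arcs that
leave `s` are deleted. -/
def dropOutGraph {V : Type*} {D : Digraph V} {G : SimpleGraph V} (hD : IsOrientation D G) (s : V) :
    SimpleGraph V where
  Adj u v := (dropOut D s).Adj u v ∨ (dropOut D s).Adj v u
  symm := ⟨fun _ _ h => h.symm⟩
  loopless := ⟨fun u h => G.irrefl ((hD.adj_iff u u).2 (h.imp And.right And.right))⟩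

section

variable {V : Type*} {D : Digraph V} {G : SimpleGraph V} {σ : Perm V} {s : V}

lemma IsOrientation.ne (hD : IsOrientation D G) {u v : V} (h : D.Adj u v) : u ≠ v :=
  ((hD.adj_iff u v).2 (Or.inl h)).ne

lemma dropOutGraph_adj (hD : IsOrientation D G) {u v : V} :
    (dropOutGraph hD s).Adj u v ↔ (u ≠ s ∧ D.Adj u v) ∨ (v ≠ s ∧ D.Adj v u) := Iff.rfl

lemma adj_iff_dropOutGraph (hD : IsOrientation D G) (u v : V) :
    G.Adj u v ↔ (dropOutGraph hD s).Adj u v ∨ (u = s ∧ D.Adj s v) ∨ (v = s ∧ D.Adj s u) := by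
  rw [dropOutGraph_adj, hD.adj_iff]
  constructor
  · rintro (h | h)
    · by_cases hu : u = s
      · exact Or.inr (Or.inl ⟨hu, hu ▸ h⟩)
      · exact Or.inl (Or.inl ⟨hu, h⟩)
    · by_cases hv : v = s
      · exact Or.inr (Or.inr ⟨hv, hv ▸ h⟩)
      · exact Or.inl (Or.inr ⟨hv, h⟩)
  · rintro (h | ⟨rfl, h⟩ | ⟨rfl, h⟩)
    · exact h.imp And.right And.right
    · exact Or.inl h
    · exact Or.inr h

lemma not_dropOutGraph_adj (hD : IsOrientation D G) {e : V} (he : D.Adj s e) :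
    ¬ (dropOutGraph hD s).Adj s e := by
  rintro (⟨h, -⟩ | ⟨-, h⟩)
  · exact h rfl
  · exact hD.asymm _ _ he h

namespace IsAlmostCyclic

lemma isSpine (h : IsAlmostCyclic D σ s) (hD : IsOrientation D G) :
    IsSpine (dropOutGraph hD s) σ s := by
  have key : ∀ u v, u ≠ s → D.Adj u v → v = σ u ∨ v = σ s := by
    intro u v hu huv
    obtain ⟨y, rfl⟩ := σ.surjective v
    by_cases hy : y = s
    · exact Or.inr (by rw [hy])
    · exact Or.inl (by rw [(h.eq_or_eq y hy u huv).resolve_right hu])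
  refine ⟨fun v hv => Or.inl ⟨hv, h.adj v hv⟩, fun v hv hv' e => ?_, ?_, ?_⟩
  · have := h.adj _ hv'
    rw [e] at this
    exact hD.asymm _ _ (h.adj v hv) this
  · rintro u v (⟨hu, huv⟩ | ⟨hv, hvu⟩)
    · have := key u v hu huv
      tauto
    · have := key v u hv hvu
      tauto
  · obtain ⟨x, hx, hxs⟩ := h.extra
    refine ⟨x, hx, fun e => ?_, Or.inl ⟨hx, hxs⟩⟩
    by_cases hs : σ s = s
    · exact hx (by rw [e, hs, hs])
    · exact hD.asymm _ _ hxs (e ▸ h.adj _ hs)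

lemma apply_eq_of_adj (h : IsAlmostCyclic D σ s) (hD : IsOrientation D G) (hs : σ s ≠ s) (v : V)
    (hv : (dropOutGraph hD s).Adj s v) : σ v = s := by
  rcases hv with ⟨h', -⟩ | ⟨hv, hvs⟩
  · exact absurd rfl h'
  · obtain ⟨y, hy⟩ := σ.surjective s
    have hys : y ≠ s := fun e => hs (by rw [e] at hy; exact hy)
    rw [← hy] at hvs
    rw [(h.eq_or_eq y hys v hvs).resolve_right hv, hy]

lemma isValidOrientation (h : IsAlmostCyclic D σ s) (hD : IsOrientation D G) :
    IsValidOrientation (dropOut D s) (dropOutGraph hD s) := by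
  refine ⟨⟨fun _ _ => Iff.rfl, fun u v huv hvu => hD.asymm u v huv.2 hvu.2⟩, fun v => ?_⟩
  by_cases hv : v = σ s
  · obtain ⟨x, hx, hxs⟩ := h.extra
    exact ⟨x, hx, hv ▸ hxs⟩
  · have hne : σ.symm v ≠ s := fun e => hv (by rw [← e, σ.apply_symm_apply])
    refine ⟨σ.symm v, hne, ?_⟩
    have := h.adj _ hne
    rwa [σ.apply_symm_apply] at this

variable [Finite V]

/-- A deleted arc from `s` to `e` can be bypassed if `e` is on the path, or if the vertex before
`e` on its cycle sends an arc to `σ s`. -/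
lemma connected (h : IsAlmostCyclic D σ s) (hD : IsOrientation D G) (hG : G.Connected)
    (htouch : ∀ e, D.Adj s e → σ.SameCycle s e ∨ D.Adj (σ.symm e) (σ s)) :
    (dropOutGraph hD s).Connected := by
  have hspine := h.isSpine hD
  have hreach : ∀ {u v}, σ.SameCycle u v → (dropOutGraph hD s).Reachable u v := fun huv =>
    reachable_of_sameCycle hspine.adj huv
  have hse : ∀ e, D.Adj s e → (dropOutGraph hD s).Reachable s e := by
    intro e he
    by_cases hsc : σ.SameCycle s e
    · exact hreach hsc
    · have hne : σ.symm e ≠ s := fun e' => hsc ⟨1, by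
        rw [zpow_one, ← e', σ.apply_symm_apply]⟩
      have h1 : (dropOutGraph hD s).Adj (σ.symm e) (σ s) :=
        Or.inl ⟨hne, (htouch e he).resolve_left hsc⟩
      exact ((hreach (Perm.sameCycle_apply_right.2 (Perm.SameCycle.refl σ s))).trans
        h1.symm.reachable).trans (hreach (Perm.sameCycle_symm_apply_left.2
          (Perm.SameCycle.refl σ e)))
  have := hG.nonempty
  refine ⟨fun u v => ?_⟩
  refine mem_of_adj_closed hG.preconnected (S := {v | (dropOutGraph hD s).Reachable u v})
    ?_ (SimpleGraph.Reachable.refl u) v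
  intro x hx y hxy
  refine SimpleGraph.Reachable.trans hx ?_
  rcases (adj_iff_dropOutGraph hD (s := s) x y).1 hxy with h1 | ⟨rfl, h1⟩ | ⟨rfl, h1⟩
  · exact h1.reachable
  · exact hse y h1
  · exact (hse x h1).symm

/-- The graph without the arcs that leave `s` belongs to `F₁`. -/
lemma exists_inF1 (h : IsAlmostCyclic D σ s) (hD : IsOrientation D G) (hG : G.Connected)
    (hs : σ s ≠ s) (htouch : ∀ e, D.Adj s e → σ.SameCycle s e ∨ D.Adj (σ.symm e) (σ s)) :
    InF1 (dropOutGraph hD s) ∧ ∃ (k : ℕ) (w : ℕ → V), IsF1Path (dropOutGraph hD s) k w ∧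
      w 0 = s ∧ w k = σ s ∧
      ∃ D', IsValidOrientation D' (offPath (dropOutGraph hD s) k w) ∧
        ∀ x, x ≠ s → (dropOutGraph hD s).Adj x (σ s) → x ≠ σ (σ s) →
          IsPartner (dropOutGraph hD s) k w D' x (σ x) := by
  have hconn := h.connected hD hG htouch
  have hpath := (h.isSpine hD).exists_isF1Path hconn.preconnected hs (h.apply_eq_of_adj hD hs)
  obtain ⟨k, w, hw, -⟩ := id hpath
  exact ⟨⟨hconn, (h.isValidOrientation hD).everyComponentHasCycle, k, w, hw⟩, hpath⟩

lemma inF_of_subsingleton (h : IsAlmostCyclic D σ s) (hD : IsValidOrientation D G)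
    (hG : G.Connected) (hs : σ s ≠ s)
    (htouch : ∀ e, D.Adj s e → σ.SameCycle s e ∨ D.Adj (σ.symm e) (σ s))
    (hE : ∀ e e', D.Adj s e → D.Adj s e' → e = e') : InF G := by
  obtain ⟨hR, k, w, hw, rfl, -, -⟩ := h.exists_inF1 hD.isOrientation hG hs htouch
  by_cases hout : ∃ e, D.Adj (w 0) e
  · obtain ⟨e, he⟩ := hout
    refine Or.inr (Or.inr ⟨hG, hD.everyComponentHasCycle, _, hR, k, w, hw, Or.inl ⟨e, ?_, ?_, ?_⟩⟩)
    · exact (hD.isOrientation.ne he).symm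
    · exact not_dropOutGraph_adj hD.isOrientation he
    · have key : ∀ v, D.Adj (w 0) v ↔ v = e := fun v => ⟨fun hv => hE v e hv he, fun hv => hv ▸ he⟩
      have hne := hD.isOrientation.ne he
      ext u v
      rw [adj_iff_dropOutGraph hD.isOrientation (s := w 0), SimpleGraph.sup_adj,
        SimpleGraph.edge_adj, key, key]
      grind
  · have : G = dropOutGraph hD.isOrientation (w 0) := by
      ext u v
      rw [adj_iff_dropOutGraph hD.isOrientation (s := w 0)]
      have hu : ¬ D.Adj (w 0) u := fun h => hout ⟨u, h⟩
      have hv : ¬ D.Adj (w 0) v := fun h => hout ⟨v, h⟩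
      simp [hu, hv]
    exact Or.inl (this ▸ hR)

lemma inF_of_pair (h : IsAlmostCyclic D σ s) (hD : IsValidOrientation D G)
    (hG : G.Connected) (hs : σ s ≠ s)
    (htouch : ∀ e, D.Adj s e → σ.SameCycle s e ∨ D.Adj (σ.symm e) (σ s))
    {a b : V} (hab : a ≠ b) (hE : ∀ e, D.Adj s e ↔ e = a ∨ e = b)
    (hcond : a = σ s ∨ deg (dropOutGraph hD.isOrientation s) (σ s) = 3 ∧ ∃ x y, x ≠ y ∧
      a = σ x ∧ b = σ y ∧ (x ≠ s ∧ D.Adj x (σ s)) ∧ (y ≠ s ∧ D.Adj y (σ s))) : InF G := by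
  obtain ⟨hR, k, w, hw, rfl, hwk, D', hD', hpart⟩ := h.exists_inF1 hD.isOrientation hG hs htouch
  have ha : D.Adj (w 0) a := (hE a).2 (Or.inl rfl)
  have hb : D.Adj (w 0) b := (hE b).2 (Or.inr rfl)
  have hane := hD.isOrientation.ne ha
  have hbne := hD.isOrientation.ne hb
  refine Or.inr (Or.inr ⟨hG, hD.everyComponentHasCycle, _, hR, k, w, hw, Or.inr
    ⟨a, b, hab, hane.symm, hbne.symm, not_dropOutGraph_adj _ ha, not_dropOutGraph_adj _ hb,
      ?_, ?_⟩⟩)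
  · have hone := hw.one_le_length
    have htwo := hw.two_le_deg
    have hk : a = w k → 1 < k := fun hak => by
      by_contra hlt
      obtain rfl : k = 1 := by omega
      exact not_dropOutGraph_adj hD.isOrientation ha (hak ▸ hw.path_adj 0 one_pos)
    rcases hcond with hat | ⟨hdeg, x, y, hxy, rfl, rfl, ⟨hx, hxt⟩, ⟨hy, hyt⟩⟩
    · have hak := hat.trans hwk.symm
      rcases (show 4 ≤ deg (dropOutGraph hD.isOrientation (w 0)) (w k) ∨
          deg (dropOutGraph hD.isOrientation (w 0)) (w k) = 3 ∨
          deg (dropOutGraph hD.isOrientation (w 0)) (w k) = 2 by omega) with h4 | h3 | h2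
      · exact Or.inl ⟨h4, hk hak, hak⟩
      · exact Or.inr (Or.inl ⟨h3, Or.inl ⟨hk hak, hak⟩⟩)
      · exact Or.inr (Or.inr ⟨h2, Or.inl ⟨hk hak, hak⟩⟩)
    · have hp : ∀ x, x ≠ w 0 → D.Adj x (σ (w 0)) →
          IsPartner (dropOutGraph hD.isOrientation (w 0)) k w D' x (σ x) := fun x hx hxt => by
        refine hpart x hx (Or.inl ⟨hx, hxt⟩) fun e => ?_
        exact hD.isOrientation.asymm _ _ hxt (e ▸ h.adj _ hs)
      exact Or.inr (Or.inl ⟨hwk ▸ hdeg, Or.inr ⟨D', hD', x, y, hxy, hp x hx hxt, hp y hy hyt⟩⟩)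
  · ext u v
    rw [adj_iff_dropOutGraph hD.isOrientation (s := w 0), SimpleGraph.sup_adj,
      SimpleGraph.sup_adj, SimpleGraph.edge_adj, SimpleGraph.edge_adj, hE, hE]
    grind

/-- If `σ` fixes `s` and no arc leaves `s`, then the other vertices form cycles. -/
lemma inF2 (h : IsAlmostCyclic D σ s) (hD : IsValidOrientation D G) (hG : G.Connected)
    (hs : σ s = s) (hout : ∀ e, ¬ D.Adj s e) {x y : V} (hxy : x ≠ y) (hx : D.Adj x s)
    (hy : D.Adj y s) : InF2 G := by
  have hO := hD.isOrientation
  have hR : dropOutGraph hO s = G := by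
    ext u v
    rw [adj_iff_dropOutGraph hO (s := s)]
    have hu := hout u
    have hv := hout v
    simp [hu, hv]
  have hspine := h.isSpine hO
  rw [hR] at hspine
  have hne : ∀ v, σ v ≠ s ↔ v ≠ s := fun v => by
    rw [Ne, Ne, not_iff_not]
    exact ⟨fun e => σ.injective (e.trans hs.symm), fun e => by rw [e, hs]⟩
  have hdeg : 2 ≤ deg G s := by
    rw [← Set.ncard_pair hxy]
    refine Set.ncard_le_ncard ?_
    rintro v (rfl | rfl)
    · exact (hO.adj_iff _ _).2 (Or.inr hx)
    · exact (hO.adj_iff _ _).2 (Or.inr hy)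
  refine ⟨hG, hD.everyComponentHasCycle, fun v => ?_, s, ⟨x, hO.ne hx⟩, ?_, ?_, hdeg⟩
  · by_cases hv : v = s
    · exact hv ▸ hdeg
    · exact hspine.two_le_deg hv
  · refine isDisjointUnionOfCycles_of_perm (σ.subtypePerm hne) (fun u v => ?_) fun u e => ?_
    · rw [Subtype.ext_iff, Subtype.ext_iff]
      constructor
      · intro huv
        rcases hspine.cases_of_adj u v huv with h1 | h1 | h1 | h1
        · exact Or.inl h1
        · exact Or.inr h1
        · exact absurd (h1.trans hs) u.2
        · exact absurd (h1.trans hs) v.2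
      · rintro (h1 | h1)
        · exact (h1 ▸ hspine.adj u u.2 : G.Adj u v)
        · exact (h1 ▸ (hspine.adj v v.2).symm : G.Adj u v)
    · exact hspine.asymm u u.2 ((hne _).2 u.2) (congrArg Subtype.val e)
  · refine exists_adj_of_component hG.preconnected (by simp) ?_
    intro u _ v _
    exact (em (v = s)).symm

end IsAlmostCyclic

end

/-! ### Orientations with few dispensable vertices -/

section

variable {V : Type*} [Finite V] {D : Digraph V} {G : SimpleGraph V} {s : V}

lemma exists_isAlmostCyclic (hs : Dispensable D s) (f : V → V)
    (hadj : ∀ v, v ≠ s → D.Adj v (f v))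
    (hf : ∀ v, v ≠ s → ∀ u, D.Adj u (f v) → u = v ∨ u = s) :
    ∃ σ : Perm V, IsAlmostCyclic D σ s ∧ ∀ v, v ≠ s → σ v = f v := by
  obtain ⟨σ, hσ⟩ := exists_perm_extend (s := s) f fun u hu v hv huv =>
    (hf v hv u (huv ▸ hadj u hu)).resolve_right hu
  exact ⟨σ, ⟨fun v hv => hσ v hv ▸ hadj v hv, fun v hv => hσ v hv ▸ hf v hv, hs (σ s)⟩, hσ⟩

/-- Each vertex other than `s` has a private out-neighbour. -/
lemma inF_of_one (hD : IsValidOrientation D G) (hG : G.Connected) (hs : Dispensable D s)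
    (g : V → V) (hg : ∀ v, v ≠ s → ∀ u, D.Adj u (g v) ↔ u = v) : InF G := by
  classical
  have hO := hD.isOrientation
  obtain ⟨σ, hσ, hσg⟩ := exists_isAlmostCyclic hs g (fun v hv => (hg v hv v).2 rfl)
    fun v hv u hu => Or.inl ((hg v hv u).1 hu)
  have hout : ∀ e, D.Adj s e → e = σ s := by
    intro e he
    obtain ⟨y, rfl⟩ := σ.surjective e
    by_cases hy : y = s
    · rw [hy]
    · rw [hσg y hy] at he
      exact absurd ((hg y hy s).1 he).symm hy
  by_cases hfix : σ s = s
  · have hout' : ∀ e, ¬ D.Adj s e := fun e he => hO.ne he ((hout e he).trans hfix).symm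
    obtain ⟨x, hxs, hx⟩ := hσ.extra
    rw [hfix] at hx
    by_cases hy : ∃ y, x ≠ y ∧ D.Adj y s
    · obtain ⟨y, hxy, hy⟩ := hy
      exact Or.inr (Or.inl (hσ.inF2 hD hG hfix hout' hxy hx hy))
    · -- `s` is a second private out-neighbour of `x`, and may be inserted after `x`
      have hxonly : ∀ u, D.Adj u s → u = x := fun u hu => by
        by_contra hne
        exact hy ⟨u, Ne.symm hne, hu⟩
      have e1 : ∀ v, v ≠ s → v ≠ x → (σ * swap s x) v = σ v := fun v hv hvx => by
        rw [Perm.mul_apply, swap_apply_of_ne_of_ne hv hvx]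
      have e2 : (σ * swap s x) x = s := by
        rw [Perm.mul_apply, swap_apply_right, hfix]
      have e3 : (σ * swap s x) s = σ x := by
        rw [Perm.mul_apply, swap_apply_left]
      have hσ' : IsAlmostCyclic D (σ * swap s x) s := by
        refine ⟨fun v hv => ?_, fun v hv u hu => ?_, ⟨x, hxs, e3 ▸ hσ.adj x hxs⟩⟩
        · by_cases hvx : v = x
          · rw [hvx, e2]
            exact hx
          · rw [e1 v hv hvx]
            exact hσ.adj v hv
        · by_cases hvx : v = x
          · rw [hvx, e2] at hu
            exact Or.inl ((hxonly u hu).trans hvx.symm)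
          · rw [e1 v hv hvx] at hu
            exact hσ.eq_or_eq v hv u hu
      refine hσ'.inF_of_subsingleton hD hG ?_ (fun e he => absurd he (hout' e))
        fun e _ he => absurd he (hout' e)
      rw [e3]
      exact fun e => hxs (σ.injective (e.trans hfix.symm))
  · refine hσ.inF_of_subsingleton hD hG hfix (fun e he => Or.inl ?_) fun e e' he he' =>
      (hout e he).trans (hout e' he').symm
    rw [hout e he]
    exact Perm.sameCycle_apply_right.2 (Perm.SameCycle.refl σ s)

lemma IsAlmostCyclic.inF_of_two {σ : Perm V} {a b : V} (hσ : IsAlmostCyclic D σ a)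
    (hD : IsValidOrientation D G) (hG : G.Connected) (hab : a ≠ b) (hz : D.Adj a (σ b))
    (hout : ∀ v, v ≠ a → v ≠ b → ¬ D.Adj a (σ v)) (hsc : σ.SameCycle a (σ b)) : InF G := by
  have hO := hD.isOrientation
  have hfix : σ a ≠ a := fun e => by
    have := hsc.eq_of_left e
    exact hO.ne hz this
  have hE : ∀ e, D.Adj a e → e = σ a ∨ e = σ b := by
    intro e he
    obtain ⟨y, rfl⟩ := σ.surjective e
    by_cases h1 : y = a
    · exact Or.inl (by rw [h1])
    by_cases h2 : y = b
    · exact Or.inr (by rw [h2])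
    · exact absurd he (hout y h1 h2)
  have htouch : ∀ e, D.Adj a e → σ.SameCycle a e ∨ D.Adj (σ.symm e) (σ a) := by
    intro e he
    rcases hE e he with rfl | rfl
    · exact Or.inl (Perm.sameCycle_apply_right.2 (Perm.SameCycle.refl σ a))
    · exact Or.inl hsc
  by_cases ht : D.Adj a (σ a)
  · refine hσ.inF_of_pair hD hG hfix htouch (fun e => hab (σ.injective e))
      (fun e => ⟨hE e, ?_⟩) (Or.inl rfl)
    rintro (rfl | rfl)
    · exact ht
    · exact hz
  · have key : ∀ e, D.Adj a e → e = σ b := fun e he =>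
      (hE e he).resolve_left fun e' => ht (e' ▸ he)
    exact hσ.inF_of_subsingleton hD hG hfix htouch fun e e' he he' =>
      (key e he).trans (key e' he').symm

/-- The vertex `z` has the in-neighbours `a` and `b`, and each other vertex has a private
out-neighbour. In the permutation with `b ↦ z`, the vertex `z` may be on a cycle to which no further
arcs lead; then the permutation with `a ↦ z` has `z` on its path. -/
lemma inF_of_two (hD : IsValidOrientation D G) (hG : G.Connected) {a b z : V} (hab : a ≠ b)
    (ha : Dispensable D a) (hb : Dispensable D b) (hz : ∀ u, D.Adj u z ↔ u = a ∨ u = b)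
    (g : V → V) (hg : ∀ v, v ≠ a → v ≠ b → ∀ u, D.Adj u (g v) ↔ u = v) : InF G := by
  classical
  let f : V → V := fun v => if v = b then z else g v
  have hfb : f b = z := if_pos rfl
  have hfv : ∀ v, v ≠ b → f v = g v := fun v hv => if_neg hv
  have hza : D.Adj a z := (hz a).2 (Or.inl rfl)
  have hzb : D.Adj b z := (hz b).2 (Or.inr rfl)
  obtain ⟨σ, hσ, hσf⟩ := exists_isAlmostCyclic ha f
    (fun v hv => by
      by_cases hvb : v = b
      · rw [hvb, hfb]; exact hzb
      · rw [hfv v hvb]; exact (hg v hv hvb v).2 rfl)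
    (fun v hv u hu => by
      by_cases hvb : v = b
      · rw [hvb, hfb, hz] at hu
        rw [hvb]
        exact hu.symm
      · rw [hfv v hvb] at hu
        exact Or.inl ((hg v hv hvb u).1 hu))
  have hσb : σ b = z := (hσf b hab.symm).trans hfb
  have hσg : ∀ v, v ≠ a → v ≠ b → σ v = g v := fun v h1 h2 => (hσf v h1).trans (hfv v h2)
  by_cases hsc : σ.SameCycle a z
  · refine hσ.inF_of_two hD hG hab (hσb ▸ hza) (fun v h1 h2 h3 => ?_) (hσb ▸ hsc)
    rw [hσg v h1 h2, hg v h1 h2] at h3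
    exact h1 h3.symm
  · have e1 : ∀ v, v ≠ a → v ≠ b → (σ * swap a b) v = σ v := fun v hv hvx => by
      rw [Perm.mul_apply, swap_apply_of_ne_of_ne hv hvx]
    have e2 : (σ * swap a b) a = z := by rw [Perm.mul_apply, swap_apply_left, hσb]
    have e3 : (σ * swap a b) b = σ a := by rw [Perm.mul_apply, swap_apply_right]
    have hσ' : IsAlmostCyclic D (σ * swap a b) b := by
      refine ⟨fun v hv => ?_, fun v hv u hu => ?_, hb _⟩
      · by_cases hva : v = a
        · rw [hva, e2]; exact hza
        · rw [e1 v hva hv]; exact hσ.adj v hva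
      · by_cases hva : v = a
        · rw [hva, e2, hz] at hu
          rwa [hva]
        · rw [e1 v hva hv, hσg v hva hv, hg v hva hv] at hu
          exact Or.inl hu
    refine hσ'.inF_of_two hD hG hab.symm (e2 ▸ hzb) (fun v h1 h2 h3 => ?_) ?_
    · rw [e1 v h2 h1, hσg v h2 h1, hg v h2 h1] at h3
      exact h1 h3.symm
    · rw [e2]
      -- the iterates of `σ` at `z` avoid `a` and reach `b`; up to there both permutations agree
      obtain ⟨n, hn⟩ := (hσb ▸ Perm.sameCycle_apply_left.2 (Perm.SameCycle.refl σ b) :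
        σ.SameCycle z b).exists_nat_pow_eq
      have key : ∀ j : ℕ, (σ * swap a b).SameCycle b z ∨
          ((σ * swap a b) ^ j) z = (σ ^ j) z := by
        intro j
        induction j with
        | zero => exact Or.inr rfl
        | succ j ih =>
          refine ih.elim Or.inl fun ih => ?_
          by_cases hj : (σ ^ j) z = b
          · exact Or.inl (Perm.SameCycle.symm ⟨j, by rw [zpow_natCast, ih, hj]⟩)
          · have hja : (σ ^ j) z ≠ a := fun e =>
              hsc (Perm.SameCycle.symm ⟨j, by rw [zpow_natCast, e]⟩)
            right
            rw [pow_succ', Perm.mul_apply, ih, e1 _ hja hj, pow_succ', Perm.mul_apply]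
      rcases key n with h | h
      · exact h
      · exact Perm.SameCycle.symm ⟨n, by rw [zpow_natCast, h, hn]⟩

/-- Each two of `a`, `b`, `c` are the in-neighbours of a vertex, and each other vertex has a private
out-neighbour. The permutation is chosen with `b ↦ zc` and `c ↦ zb`; then `za` follows `a`. -/
lemma inF_of_three (hD : IsValidOrientation D G) (hG : G.Connected) {a b c za zb zc : V}
    (hab : a ≠ b) (hac : a ≠ c) (hbc : b ≠ c) (ha : Dispensable D a)
    (hza : ∀ u, D.Adj u za ↔ u = b ∨ u = c) (hzb : ∀ u, D.Adj u zb ↔ u = a ∨ u = c)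
    (hzc : ∀ u, D.Adj u zc ↔ u = a ∨ u = b) (hne : za ≠ a) (g : V → V)
    (hg : ∀ v, v ≠ a → v ≠ b → v ≠ c → ∀ u, D.Adj u (g v) ↔ u = v) : InF G := by
  classical
  have hO := hD.isOrientation
  let f : V → V := fun v => if v = b then zc else if v = c then zb else g v
  have hfb : f b = zc := if_pos rfl
  have hfc : f c = zb := (if_neg hbc.symm).trans (if_pos rfl)
  have hfv : ∀ v, v ≠ b → v ≠ c → f v = g v := fun v h1 h2 => (if_neg h1).trans (if_neg h2)
  obtain ⟨σ, hσ, hσf⟩ := exists_isAlmostCyclic ha f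
    (fun v hv => by
      by_cases h1 : v = b
      · rw [h1, hfb, hzc]; exact Or.inr rfl
      by_cases h2 : v = c
      · rw [h2, hfc, hzb]; exact Or.inr rfl
      · rw [hfv v h1 h2, hg v hv h1 h2])
    (fun v hv u hu => by
      by_cases h1 : v = b
      · rw [h1, hfb, hzc] at hu
        rw [h1]; exact hu.symm
      by_cases h2 : v = c
      · rw [h2, hfc, hzb] at hu
        rw [h2]; exact hu.symm
      · rw [hfv v h1 h2, hg v hv h1 h2] at hu
        exact Or.inl hu)
  have hσb : σ b = zc := (hσf b hab.symm).trans hfb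
  have hσc : σ c = zb := (hσf c hac.symm).trans hfc
  have hσa : σ a = za := by
    obtain ⟨y, hy⟩ := σ.surjective za
    by_cases hya : y = a
    · rw [← hya, hy]
    · have hb := hσ.eq_or_eq y hya b (by rw [hy, hza]; exact Or.inl rfl)
      have hc := hσ.eq_or_eq y hya c (by rw [hy, hza]; exact Or.inr rfl)
      exact absurd ((hb.resolve_right hab.symm).trans (hc.resolve_right hac.symm).symm) hbc
  have hE : ∀ e, D.Adj a e ↔ e = zc ∨ e = zb := by
    intro e
    constructor
    · intro he
      obtain ⟨y, rfl⟩ := σ.surjective e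
      by_cases h0 : y = a
      · rw [h0, hσa, hza] at he
        tauto
      by_cases h1 : y = b
      · exact Or.inl (h1 ▸ hσb)
      by_cases h2 : y = c
      · exact Or.inr (h2 ▸ hσc)
      · rw [hσf y h0, hfv y h1 h2, hg y h0 h1 h2] at he
        exact absurd he.symm h0
    · rintro (rfl | rfl)
      · exact (hzc a).2 (Or.inl rfl)
      · exact (hzb a).2 (Or.inl rfl)
  have hbt : D.Adj b (σ a) := by rw [hσa, hza]; exact Or.inl rfl
  have hct : D.Adj c (σ a) := by rw [hσa, hza]; exact Or.inr rfl
  have hfix : σ a ≠ a := hσa ▸ hne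
  have htouch : ∀ e, D.Adj a e → σ.SameCycle a e ∨ D.Adj (σ.symm e) (σ a) := by
    intro e he
    rcases (hE e).1 he with rfl | rfl
    · right
      rwa [← hσb, σ.symm_apply_apply]
    · right
      rwa [← hσc, σ.symm_apply_apply]
  have hbσ : b ≠ σ (σ a) := fun e => hO.asymm _ _ hbt (e ▸ hσ.adj _ hfix)
  have hcσ : c ≠ σ (σ a) := fun e => hO.asymm _ _ hct (e ▸ hσ.adj _ hfix)
  refine hσ.inF_of_pair hD hG hfix htouch
    (fun e => hbc (σ.injective (hσb.trans (e.trans hσc.symm)))) hE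
    (Or.inr ⟨?_, b, c, hbc, hσb.symm, hσc.symm, ⟨hab.symm, hbt⟩, ⟨hac.symm, hct⟩⟩)
  refine Set.ncard_eq_three.2 ⟨σ (σ a), b, c, hbσ.symm, hcσ.symm, hbc, ?_⟩
  ext v
  simp only [SimpleGraph.mem_neighborSet, dropOutGraph_adj, Set.mem_insert_iff,
    Set.mem_singleton_iff]
  constructor
  · rintro (⟨-, hv⟩ | ⟨hv, hvt⟩)
    · obtain ⟨y, rfl⟩ := σ.surjective v
      by_cases hya : y = a
      · rw [hya] at hv
        exact absurd rfl (hO.ne hv)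
      · left
        rw [(hσ.eq_or_eq y hya _ hv).resolve_right hfix]
    · rw [hσa, hza] at hvt
      exact Or.inr hvt
  · rintro (rfl | rfl | rfl)
    · exact Or.inl ⟨hfix, hσ.adj _ hfix⟩
    · exact Or.inr ⟨hab.symm, hbt⟩
    · exact Or.inr ⟨hac.symm, hct⟩

end

/-- The in-neighbourhoods include the singletons of all vertices that are not dispensable and all
pairs of dispensable vertices, hence `n - b + b (b - 1) / 2 ≤ n` for `b` dispensable vertices. -/
lemma card_dispensable_le {V : Type*} [Fintype V] [DecidableEq V] {D : Digraph V} (B : Finset V)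
    (h1 : ∀ p ∉ B, ∃ v, ∀ u, D.Adj u v ↔ u = p)
    (h2 : ∀ p ∈ B, ∀ q ∈ B, p ≠ q → ∃ v, ∀ u, D.Adj u v ↔ u = p ∨ u = q) : B.card ≤ 3 := by
  classical
  let N : V → Finset V := fun v => Finset.univ.filter fun u => D.Adj u v
  have hsub : Bᶜ.image (fun p => ({p} : Finset V)) ∪ B.powersetCard 2 ⊆
      Finset.univ.image N := by
    intro S hS
    rcases Finset.mem_union.1 hS with hS | hS
    · obtain ⟨p, hp, rfl⟩ := Finset.mem_image.1 hS
      obtain ⟨v, hv⟩ := h1 p (Finset.mem_compl.1 hp)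
      refine Finset.mem_image.2 ⟨v, Finset.mem_univ v, ?_⟩
      ext u
      simp [N, hv]
    · obtain ⟨hSB, hcard⟩ := Finset.mem_powersetCard.1 hS
      obtain ⟨p, q, hpq, rfl⟩ := Finset.card_eq_two.1 hcard
      obtain ⟨v, hv⟩ := h2 p (hSB (by simp)) q (hSB (by simp)) hpq
      refine Finset.mem_image.2 ⟨v, Finset.mem_univ v, ?_⟩
      ext u
      simp [N, hv]
  have hdisj : Disjoint (Bᶜ.image (fun p => ({p} : Finset V))) (B.powersetCard 2) := by
    rw [Finset.disjoint_left]
    intro S hS hS'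
    obtain ⟨p, -, rfl⟩ := Finset.mem_image.1 hS
    simpa using (Finset.mem_powersetCard.1 hS').2
  have hle := (Finset.card_le_card hsub).trans Finset.card_image_le
  rw [Finset.card_union_of_disjoint hdisj, Finset.card_powersetCard,
    Finset.card_image_of_injective _ Finset.singleton_injective, Finset.card_univ] at hle
  have hcompl := Finset.card_add_card_compl B
  have hchoose : B.card.choose 2 ≤ B.card := by omega
  by_contra! hlt
  rw [Nat.choose_two_right] at hchoose
  have : B.card * 3 ≤ B.card * (B.card - 1) := Nat.mul_le_mul_left _ (by omega)
  omega

lemma inF_of_pairCritical {V : Type*} [Finite V] {D : Digraph V} {G : SimpleGraph V}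
    (hD : IsValidOrientation D G) (hG : G.Connected) (hcrit : PairCritical D)
    (hdisp : ∃ x, Dispensable D x) : InF G := by
  classical
  have := Fintype.ofFinite V
  have h1 : ∀ p, ¬ Dispensable D p → ∃ v, ∀ u, D.Adj u v ↔ u = p := by
    intro p hp
    simp only [Dispensable, not_forall, not_exists, not_and] at hp
    obtain ⟨v, hv⟩ := hp
    have hv' : ∀ u, D.Adj u v → u = p := fun u hu => by
      by_contra hne
      exact hv u hne hu
    obtain ⟨u, hu⟩ := hD.in_pos v
    exact ⟨v, fun u' => ⟨hv' u', fun e => e ▸ hv' u hu ▸ hu⟩⟩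
  have h2 : ∀ p q, Dispensable D p → Dispensable D q → p ≠ q →
      ∃ v, ∀ u, D.Adj u v ↔ u = p ∨ u = q := by
    intro p q hp hq hpq
    obtain ⟨v, hv⟩ := hcrit p q hpq
    obtain ⟨x, hx, hxv⟩ := hp v
    obtain ⟨y, hy, hyv⟩ := hq v
    obtain rfl := (hv x hxv).resolve_left hx
    obtain rfl := (hv y hyv).resolve_right hy
    exact ⟨v, fun u => ⟨hv u, by rintro (rfl | rfl) <;> assumption⟩⟩
  have hg : ∀ p, ∃ v, ¬ Dispensable D p → ∀ u, D.Adj u v ↔ u = p := fun p => by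
    by_cases hp : Dispensable D p
    · exact ⟨p, fun h => absurd hp h⟩
    · exact (h1 p hp).imp fun v hv _ => hv
  choose g hg using hg
  let B : Finset V := Finset.univ.filter (Dispensable D)
  have hB : ∀ v, v ∈ B ↔ Dispensable D v := fun v => by simp [B]
  have hle := card_dispensable_le B (fun p hp => h1 p (mt (hB p).2 hp))
    fun p hp q hq => h2 p q ((hB p).1 hp) ((hB q).1 hq)
  have hpos : 0 < B.card := Finset.card_pos.2 (hdisp.imp fun x hx => (hB x).2 hx)
  obtain hc | hc | hc : B.card = 1 ∨ B.card = 2 ∨ B.card = 3 := by omega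
  · obtain ⟨s, hs⟩ := Finset.card_eq_one.1 hc
    have hB' : ∀ v, Dispensable D v ↔ v = s := fun v => by rw [← hB, hs]; simp
    exact inF_of_one hD hG ((hB' s).2 rfl) g fun v hv => hg v (mt (hB' v).1 hv)
  · obtain ⟨a, b, hab, hs⟩ := Finset.card_eq_two.1 hc
    have hB' : ∀ v, Dispensable D v ↔ v = a ∨ v = b := fun v => by rw [← hB, hs]; simp
    have ha := (hB' a).2 (Or.inl rfl)
    have hb := (hB' b).2 (Or.inr rfl)
    obtain ⟨z, hz⟩ := h2 a b ha hb hab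
    exact inF_of_two hD hG hab ha hb hz g fun v hva hvb =>
      hg v (mt (hB' v).1 (by tauto))
  · obtain ⟨a, b, c, hab, hac, hbc, hs⟩ := Finset.card_eq_three.1 hc
    have hB' : ∀ v, Dispensable D v ↔ v = a ∨ v = b ∨ v = c := fun v => by
      rw [← hB, hs]; simp
    have ha := (hB' a).2 (Or.inl rfl)
    have hb := (hB' b).2 (Or.inr (Or.inl rfl))
    have hc' := (hB' c).2 (Or.inr (Or.inr rfl))
    obtain ⟨za, hza⟩ := h2 b c hb hc' hbc
    obtain ⟨zb, hzb⟩ := h2 a c ha hc' hac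
    obtain ⟨zc, hzc⟩ := h2 a b ha hb hab
    by_cases hne : za = a
    · -- `za = a` and `zb = b` would give arcs in both directions between `a` and `b`
      have hne' : zb ≠ b := by
        rintro rfl
        exact hD.isOrientation.asymm zb a (hne ▸ (hza zb).2 (Or.inl rfl))
          ((hzb a).2 (Or.inl rfl))
      exact inF_of_three hD hG hab.symm hbc hac hb hzb hza
        (fun u => (hzc u).trans or_comm) hne' g fun v h1 h2 h3 => hg v (mt (hB' v).1 (by tauto))
    · exact inF_of_three hD hG hab hac hbc ha hza hzb hzc hne g
        fun v h1 h2 h3 => hg v (mt (hB' v).1 (by tauto))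

/-! ### Restriction to components -/

/-- The digraph induced by `D` on a set of vertices. -/
def inducedDigraph {V : Type*} (D : Digraph V) (S : Set V) : Digraph S := ⟨fun u v => D.Adj u v⟩

section

variable {V : Type*} {D : Digraph V} {G : SimpleGraph V}

lemma IsOrientation.mem_supp (hD : IsOrientation D G) (c : G.ConnectedComponent) {u v : V}
    (h : D.Adj u v) (hv : v ∈ c.supp) : u ∈ c.supp :=
  c.mem_supp_of_adj_mem_supp hv ((hD.adj_iff v u).2 (Or.inr h))

lemma IsValidOrientation.restrict (hD : IsValidOrientation D G) (c : G.ConnectedComponent) :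
    IsValidOrientation (inducedDigraph D c.supp) c.toSimpleGraph := by
  refine ⟨⟨fun u v => hD.isOrientation.adj_iff u v, fun u v => hD.isOrientation.asymm u v⟩,
    fun v => ?_⟩
  obtain ⟨u, hu⟩ := hD.in_pos v
  exact ⟨⟨u, hD.isOrientation.mem_supp c hu v.2⟩, hu⟩

lemma PairCritical.restrict (hD : IsValidOrientation D G) (h : PairCritical D)
    (c : G.ConnectedComponent) : PairCritical (inducedDigraph D c.supp) := by
  intro p q hpq
  obtain ⟨v, hv⟩ := h p q fun e => hpq (Subtype.ext e)
  obtain ⟨u, hu⟩ := hD.in_pos v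
  have hvc : v ∈ c.supp := by
    refine c.mem_supp_of_adj_mem_supp (u := u) ?_ ((hD.isOrientation.adj_iff u v).2 (Or.inl hu))
    rcases hv u hu with rfl | rfl
    · exact p.2
    · exact q.2
  exact ⟨⟨v, hvc⟩, fun u hu => (hv u hu).imp Subtype.ext Subtype.ext⟩

lemma Dispensable.restrict (hD : IsValidOrientation D G) {x : V} (h : Dispensable D x) :
    Dispensable (inducedDigraph D (G.connectedComponentMk x).supp) ⟨x, rfl⟩ := by
  intro v
  obtain ⟨u, hux, hu⟩ := h v
  exact ⟨⟨u, hD.isOrientation.mem_supp _ hu v.2⟩, fun e => hux (congrArg Subtype.val e), hu⟩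

lemma Dispensable.of_restrict (hD : IsValidOrientation D G) (c : G.ConnectedComponent)
    {x : c.supp} (h : Dispensable (inducedDigraph D c.supp) x) : Dispensable D x := by
  intro v
  by_cases hv : v ∈ c.supp
  · obtain ⟨u, hux, hu⟩ := h ⟨v, hv⟩
    exact ⟨u, fun e => hux (Subtype.ext e), hu⟩
  · obtain ⟨u, hu⟩ := hD.in_pos v
    refine ⟨u, fun e => hv ?_, hu⟩
    exact c.mem_supp_of_adj_mem_supp x.2 (e ▸ (hD.isOrientation.adj_iff u v).2 (Or.inl hu))

/-- Dispensable vertices in different components could be left out at the same time. -/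
lemma PairCritical.eq_connectedComponentMk (hD : IsValidOrientation D G) (h : PairCritical D)
    {x y : V} (hx : Dispensable D x) (hy : Dispensable D y) :
    G.connectedComponentMk x = G.connectedComponentMk y := by
  by_cases hxy : x = y
  · rw [hxy]
  obtain ⟨v, hv⟩ := h x y hxy
  have hvx : D.Adj x v := by
    obtain ⟨u, huy, hu⟩ := hy v
    exact (hv u hu).resolve_right huy ▸ hu
  have hvy : D.Adj y v := by
    obtain ⟨u, hux, hu⟩ := hx v
    exact (hv u hu).resolve_left hux ▸ hu
  have h1 := (hD.isOrientation.adj_iff x v).2 (Or.inl hvx)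
  have h2 := (hD.isOrientation.adj_iff y v).2 (Or.inl hvy)
  exact SimpleGraph.ConnectedComponent.sound (h1.reachable.trans h2.symm.reachable)

lemma isCycleGraph_of_forall_not_dispensable [Finite V] (hD : IsValidOrientation D G)
    (hG : G.Connected) (h : ∀ x, ¬ Dispensable D x) : IsCycleGraph G := by
  obtain ⟨σ, hσ⟩ := exists_perm_of_forall_not_dispensable hD.in_pos h
  refine isCycleGraph_of_perm hG σ (fun u v => ?_) fun u e => ?_
  · rw [hD.isOrientation.adj_iff, hσ, hσ]
  · exact hD.isOrientation.asymm u (σ u) ((hσ _ _).2 rfl) ((hσ _ _).2 e.symm)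

end

end OrientableTotalDomination

theorem theorem1 {V : Type*} [Fintype V] (G : SimpleGraph V)
    (hG : OrientableTotalDomination.EveryComponentHasCycle G) :
    (G.Connected →
      (OrientableTotalDomination.upperOrientableTotalDominationNumber G + 1 = Fintype.card V ↔
        OrientableTotalDomination.InF G)) ∧
    (¬ G.Connected →
      OrientableTotalDomination.upperOrientableTotalDominationNumber G + 1 = Fintype.card V →
        ∃ c₀ : G.ConnectedComponent, OrientableTotalDomination.InF c₀.toSimpleGraph ∧
          ∀ c : G.ConnectedComponent, c ≠ c₀ →
            OrientableTotalDomination.IsCycleGraph c.toSimpleGraph) := by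
  open OrientableTotalDomination in
  refine ⟨fun hconn => ⟨fun h => ?_, fun h => h.upperOrientableTotalDominationNumber_add_one⟩,
    fun _ h => ?_⟩
  · obtain ⟨D, hD, hcrit, hdisp⟩ := exists_pairCritical hG h
    exact inF_of_pairCritical hD hconn hcrit hdisp
  · obtain ⟨D, hD, hcrit, x, hx⟩ := exists_pairCritical hG h
    refine ⟨G.connectedComponentMk x, inF_of_pairCritical (hD.restrict _)
      (SimpleGraph.ConnectedComponent.connected_toSimpleGraph _) (hcrit.restrict hD _)
      ⟨_, hx.restrict hD⟩, fun c hc => ?_⟩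
    refine isCycleGraph_of_forall_not_dispensable (hD.restrict c) c.connected_toSimpleGraph
      fun y hy => hc ?_
    have hyc : G.connectedComponentMk y = c := y.2
    rw [← hyc]
    exact hcrit.eq_connectedComponentMk hD (hy.of_restrict hD c) hx
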